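/- Let $n,s,N\ge 0$ be integers and $M=M_F+M_B\ge 1$ with integers $M_F,M_B\ge 0$. Consider $x_{k+1}=A_kx_k+B_ku_k+w_k$ for $0\le k<N$, with $x_k\in\mathbb R^n$, $u_k\in\mathbb R^s$, deterministic $x_0$, real matrices $A_k,B_k$, and independent zero-mean disturbances $w_0,\dots,w_{N-1}$ with finite second moments. Let $(\tau_k)$ be a $\{0,1\}$-valued Markov chain (the ON/OFF state of the fog endpoint), independent of the disturbances, with given $\tau_0$ and $P(\tau_{k+1}=1\mid\tau_k=1)=p$, $P(\tau_{k+1}=1\mid\tau_k=0)=1-q$, where $p,q\in[0,1]$. Let $Q_0,\dots,Q_N$ be positive semidefinite and $R_0,\dots,R_{N-1}$ positive definite (symmetric) matrices. A feasible policy is a sequence of measurable rules $u_k=\pi_k(H_k,\tau_{k-M_B})$ for $0\le k<N$, where $H_k$ consists of the states $x_i$, $0\le i\le k-M$, for which $\tau_{i+M_F}=1$ (together with the indices $i$ of these states), and of the controls $u_i$, $0\le i\le k-1$, such that $\pi_k(\cdot,0)=0$ and $\pi_k=0$ unless $k$ is a positive multiple of $M$. Put $$J^{\pi}(p,q)=\mathbb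 E\Big[x_N^\top Q_Nx_N+\sum_{k=0}^{N-1}\big(x_k^\top Q_kx_k+u_k^\top R_ku_k\big)\Big]\in[0,\infty],\qquad J^\star(p,q)=\inf_{\pi\text{ feasible}}J^\pi(p,q),$$ both depending also on $(x_0,\tau_0)$. For $r\in[0,1]$ let $K_N=Q_N$ and, for $k=N-1,\dots,0$, $V_k=(R_k+B_k^\top K_{k+1}B_k)^{-1}B_k^\top K_{k+1}A_k$, $L_k=Q_k+A_k^\top K_{k+1}A_k$, $\Lambda_k=A_k^\top K_{k+1}B_kV_k$, and $K_k=L_k-r\Lambda_k$ if $M\mid k$, $K_k=L_k$ otherwise. Let $\pi^{(r)}$ be the policy with $u_k=-V_k\,\mathbb E[x_k\mid x_{k-M},u_{k-M}]$ if $k$ is a positive multiple of $M$ and $\tau_{k-M_B}=1$, and $u_k=0$ otherwise. Assume $p>1-q$. Then for all $x_0\in\mathbb R^n$ and $\tau_0\in\{0,1\}$: $$J^\star(p,1-p)\le J^\star(p,q)\le J^\star(1-q,q)<\infty .$$ Moreover, $\pi^{(1-q)}$ is feasible, it is the optimal controller of the system with parameters $(1-q,q)$, that is $J^{\pi^{(1-q)}}(1-q,q)=J^\star(1-q,q)$,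 and in the system with parameters $(p,q)$ its cost also lies between the two bounds: $$J^\star(p,1-p)\le J^{\pi^{(1-q)}}(p,q)\le J^\star(1-q,q).$$ -/

import Mathlib

open MeasureTheory ProbabilityTheory Matrix
open scoped ENNReal

noncomputable section

namespace Fog

/-- The data of a finite-horizon linear-quadratic control problem over a fog endpoint: horizon `N`,
forward delay `MF`, backward delay `MB`, dynamics `x (k+1) = A k x k + B k u k + w k` and cost
weights `Q`, `R`.  Only the entries `A k, B k, R k` with `k < N` and `Q k` with `k ≤ N` matter. -/
structure Plant (n s : ℕ) where
  N : ℕ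
  MF : ℕ
  MB : ℕ
  A : ℕ → Matrix (Fin n) (Fin n) ℝ
  B : ℕ → Matrix (Fin n) (Fin s) ℝ
  Q : ℕ → Matrix (Fin n) (Fin n) ℝ
  R : ℕ → Matrix (Fin s) (Fin s) ℝ

/-- Total delay. -/
def Plant.M {n s : ℕ} (S : Plant n s) : ℕ := S.MF + S.MB

/-- One-step transition probabilities of the fog endpoint (`true` is ON, `false` is OFF). -/
def fogTrans (p q : ℝ) : Bool → Bool → ℝ
  | true, true => p
  | true, false => 1 - p
  | false, true => 1 - q
  | false, false => q

/-- Law of the path `(τ 0, …, τ N)` of the two-state Markov chain started at `τ₀`. -/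
def fogLaw (N : ℕ) (p q : ℝ) (τ₀ : Bool) : Measure (Fin (N + 1) → Bool) :=
  ∑ t : Fin (N + 1) → Bool,
    ENNReal.ofReal (if t 0 = τ₀ then ∏ k : Fin N, fogTrans p q (t k.castSucc) (t k.succ) else 0) •
      Measure.dirac t

/-- A finite path as a sequence; the padding values are never used by a feasible policy. -/
def extendPath {N : ℕ} (t : Fin (N + 1) → Bool) (k : ℕ) : Bool :=
  if h : k < N + 1 then t ⟨k, h⟩ else false

/-- Measurements known to the controller: entry `i` is `(true, x i)` if `x i` was received, and
`(false, 0)` otherwise. -/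
abbrev Obs (n : ℕ) : Type := ℕ → Bool × (Fin n → ℝ)

/-- A policy: `π k o u b` is the control applied at the plant at time `k`, computed from the received
measurements `o`, the previous controls `u` (zero from index `k` on), and the state `b` that the fog
endpoint has when it generates this control. -/
abbrev Policy (n s : ℕ) : Type := ℕ → Obs n → (ℕ → Fin s → ℝ) → Bool → Fin s → ℝ

variable {n s : ℕ}

/-- Feasibility: measurable rules, no control from an endpoint that is OFF, and controls arriving at
the plant only at the times `M, 2M, 3M, …`. -/
structure Feasible (S : Plant n s) (π : Policy n s) : Prop where
  measurable : ∀ k < S.N,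
    Measurable (fun h : Obs n × (ℕ → Fin s → ℝ) × Bool => π k h.1 h.2.1 h.2.2)
  off : ∀ k < S.N, ∀ o u, π k o u false = 0
  spread : ∀ k < S.N, (k = 0 ∨ ¬ S.M ∣ k) → ∀ o u b, π k o u b = 0

/-- The measurements that can be used for the control that arrives at the plant at time `k` (and is
generated at time `k - MB`): `x i` reaches the endpoint at time `i + MF ≤ k - MB`, and is received
exactly when the endpoint is ON at that time. -/
def received (S : Plant n s) (τ : ℕ → Bool) (k : ℕ) (x : ℕ → Fin n → ℝ) : Obs n :=
  fun i => if i + S.M ≤ k ∧ τ (i + S.MF) = true then (true, x i) else (false, 0)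

/-- Closed loop run up to time `k` under noise `w` and endpoint states `τ`: the states
`x 0, …, x k` and the controls `u 0, …, u (k-1)`, padded by zeros. -/
def run (S : Plant n s) (π : Policy n s) (x₀ : Fin n → ℝ) (w : ℕ → Fin n → ℝ) (τ : ℕ → Bool) :
    ℕ → (ℕ → Fin n → ℝ) × (ℕ → Fin s → ℝ)
  | 0 => (Function.update 0 0 x₀, 0)
  | k + 1 =>
    let r := run S π x₀ w τ k
    let u := π k (received S τ k r.1) r.2 (τ (k - S.MB))
    (Function.update r.1 (k + 1) (S.A k *ᵥ r.1 k + S.B k *ᵥ u + w k), Function.update r.2 k u)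

/-- State at time `k`. -/
def state (S : Plant n s) (π : Policy n s) (x₀ : Fin n → ℝ) (w : ℕ → Fin n → ℝ) (τ : ℕ → Bool)
    (k : ℕ) : Fin n → ℝ :=
  (run S π x₀ w τ k).1 k

/-- Control applied at time `k`. -/
def ctrl (S : Plant n s) (π : Policy n s) (x₀ : Fin n → ℝ) (w : ℕ → Fin n → ℝ) (τ : ℕ → Bool)
    (k : ℕ) : Fin s → ℝ :=
  (run S π x₀ w τ (k + 1)).2 k

/-- Total quadratic cost along one realization. -/
def pathCost (S : Plant n s) (π : Policy n s) (x₀ : Fin n → ℝ) (w : ℕ → Fin n → ℝ) (τ : ℕ → Bool) :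
    ℝ :=
  state S π x₀ w τ S.N ⬝ᵥ (S.Q S.N *ᵥ state S π x₀ w τ S.N) +
    ∑ k ∈ Finset.range S.N,
      (state S π x₀ w τ k ⬝ᵥ (S.Q k *ᵥ state S π x₀ w τ k) +
        ctrl S π x₀ w τ k ⬝ᵥ (S.R k *ᵥ ctrl S π x₀ w τ k))

variable {Ω : Type*} [MeasurableSpace Ω]

/-- Expected total cost `J^π(p, q)`; the noise and the endpoint process are independent.  The path
cost is nonnegative, so its expectation is taken in `[0, ∞]`. -/
def cost (S : Plant n s) (μ : Measure Ω) (w : ℕ → Ω → Fin n → ℝ) (x₀ : Fin n → ℝ) (τ₀ : Bool)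
    (p q : ℝ) (π : Policy n s) : ℝ≥0∞ :=
  ∫⁻ z, ENNReal.ofReal (pathCost S π x₀ (fun k => w k z.1) (extendPath z.2))
    ∂(μ.prod (fogLaw S.N p q τ₀))

/-- Minimum cost `J*(p, q)` over all feasible policies. -/
def minCost (S : Plant n s) (μ : Measure Ω) (w : ℕ → Ω → Fin n → ℝ) (x₀ : Fin n → ℝ) (τ₀ : Bool)
    (p q : ℝ) : ℝ≥0∞ :=
  ⨅ (π : Policy n s) (_ : Feasible S π), cost S μ w x₀ τ₀ p q π

/-- `V k` as a function of `K = K (k+1)`. -/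
def gainOf (S : Plant n s) (k : ℕ) (K : Matrix (Fin n) (Fin n) ℝ) : Matrix (Fin s) (Fin n) ℝ :=
  (S.R k + (S.B k)ᵀ * K * S.B k)⁻¹ * (S.B k)ᵀ * K * S.A k

/-- `K k` as a function of `K = K (k+1)`, with ON-probability `r`. -/
def riccatiStep (S : Plant n s) (r : ℝ) (k : ℕ) (K : Matrix (Fin n) (Fin n) ℝ) :
    Matrix (Fin n) (Fin n) ℝ :=
  S.Q k + (S.A k)ᵀ * K * S.A k -
    if S.M ∣ k then r • ((S.A k)ᵀ * K * S.B k * gainOf S k K) else 0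

/-- `riccatiRev S r j` is `K (N - j)`. -/
def riccatiRev (S : Plant n s) (r : ℝ) : ℕ → Matrix (Fin n) (Fin n) ℝ
  | 0 => S.Q S.N
  | j + 1 => riccatiStep S r (S.N - (j + 1)) (riccatiRev S r j)

/-- The matrices `K k`, for `k ≤ N`. -/
def riccati (S : Plant n s) (r : ℝ) (k : ℕ) : Matrix (Fin n) (Fin n) ℝ :=
  riccatiRev S r (S.N - k)

/-- State at time `i + j` if the state at time `i` is `x`, the control at time `i` is `u`, and no
control arrives after that. -/
def drift (S : Plant n s) (w : ℕ → Fin n → ℝ) (i : ℕ) (x : Fin n → ℝ) (u : Fin s → ℝ) :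
    ℕ → Fin n → ℝ
  | 0 => x
  | j + 1 => S.A (i + j) *ᵥ drift S w i x u j + (if j = 0 then S.B i *ᵥ u else 0) + w (i + j)

/-- `E[x k | x (k-M) = x, u (k-M) = u]` for `M ∣ k`, `0 < k`. -/
def predict (S : Plant n s) (μ : Measure Ω) (w : ℕ → Ω → Fin n → ℝ) (k : ℕ) (x : Fin n → ℝ)
    (u : Fin s → ℝ) : Fin n → ℝ :=
  ∫ ω, drift S (fun l => w l ω) (k - S.M) x u S.M ∂μ

/-- The optimal delayed controller of the symmetric endpoint with ON-probability `r`: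
`-V k E[x k | x (k-M), u (k-M)]` if `k` is a positive multiple of `M` and the endpoint is ON when it
generates the control, and `0` otherwise. -/
def symPolicy (S : Plant n s) (μ : Measure Ω) (w : ℕ → Ω → Fin n → ℝ) (r : ℝ) : Policy n s :=
  fun k o u b =>
    if 0 < k ∧ S.M ∣ k ∧ b = true then
      -(gainOf S k (riccati S r (k + 1)) *ᵥ predict S μ w k (o (k - S.M)).2 (u (k - S.M)))
    else 0

end Fog

end

/-! Fix any `r` in `[0, 1]` and the matrices `K_k` built with it. Telescoping `x_kᵀ K_k x_k` and
completing squares gives, along each fixed path of the endpoint, an exact mean cost for every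
feasible policy with square integrable controls (`integral_pathCost`): a policy-independent part
plus, at each control time `k`, the term `1_ON * deviation + (r - 1_ON) * predReduction`, where ON
refers to time `k - MB`. The state is split into its prediction from time `k - M` and an error
driven by later disturbances only. The control at time `k` is a function of the disturbances before
`k - M`, so the cross terms vanish.

Both mean squares are nonnegative, and `predReduction` depends only on endpoint states before time
`k - MB`. Averaging over the chain (`sum_pathProb_mul_nonneg`) therefore replaces `r - 1_ON` by `r`
minus a transition probability, which has a known sign. If all ON-probabilities are at most `r`,
every policy costs at least `symCost` at `r` (`symCost_le_cost`). If all are at least `r`, then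
`symPolicy` at `r`, which makes the deviation vanish whenever the endpoint is ON, costs at most that
value (`cost_symPolicy_le`).

For parameters `(r, 1 - r)` both bounds apply, so the minimum is `symCost` at `r`. For `(p, q)` the
ON-probabilities are `p` and `1 - q < p`: every policy costs at least `symCost` at `p`, and
`symPolicy` at `1 - q` costs at most `symCost` at `1 - q`. -/

noncomputable section

namespace Fog

/-! ### Quadratic forms and the Riccati recursion. -/

section

/-- The quadratic form of a matrix. -/
def quad {m : ℕ} (K : Matrix (Fin m) (Fin m) ℝ) (x : Fin m → ℝ) : ℝ := x ⬝ᵥ (K *ᵥ x)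

theorem quad_add {m : ℕ} (K : Matrix (Fin m) (Fin m) ℝ) (x y : Fin m → ℝ) :
    quad K (x + y) = quad K x + quad K y + (x ⬝ᵥ (K *ᵥ y) + y ⬝ᵥ (K *ᵥ x)) := by
  simp only [quad, mulVec_add, add_dotProduct, dotProduct_add]; ring

theorem quad_zero {m : ℕ} (K : Matrix (Fin m) (Fin m) ℝ) : quad K 0 = 0 := by simp [quad]

theorem quad_mulVec {m l : ℕ} (K : Matrix (Fin m) (Fin m) ℝ) (C : Matrix (Fin m) (Fin l) ℝ)
    (x : Fin l → ℝ) : quad K (C *ᵥ x) = quad (Cᵀ * K * C) x := by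
  simp only [quad, ← mulVec_mulVec]
  rw [dotProduct_mulVec x, vecMul_transpose]

theorem quad_matrix_add {m : ℕ} (K L : Matrix (Fin m) (Fin m) ℝ) (x : Fin m → ℝ) :
    quad (K + L) x = quad K x + quad L x := by
  simp [quad, add_mulVec]

theorem quad_matrix_sub {m : ℕ} (K L : Matrix (Fin m) (Fin m) ℝ) (x : Fin m → ℝ) :
    quad (K - L) x = quad K x - quad L x := by
  simp [quad, sub_mulVec]

theorem quad_matrix_smul {m : ℕ} (c : ℝ) (K : Matrix (Fin m) (Fin m) ℝ) (x : Fin m → ℝ) :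
    quad (c • K) x = c * quad K x := by
  simp [quad, smul_mulVec]

theorem quad_nonneg {m : ℕ} {K : Matrix (Fin m) (Fin m) ℝ} (hK : K.PosSemidef) (x : Fin m → ℝ) :
    0 ≤ quad K x := by
  simpa [quad] using hK.dotProduct_mulVec_nonneg x

theorem transpose_eq_of_posSemidef {m : ℕ} {K : Matrix (Fin m) (Fin m) ℝ} (hK : K.PosSemidef) :
    Kᵀ = K := by
  simpa [Matrix.IsHermitian] using hK.1

theorem posSemidef_of_quad_nonneg {m : ℕ} {K : Matrix (Fin m) (Fin m) ℝ} (hK : Kᵀ = K)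
    (h : ∀ x, 0 ≤ quad K x) : K.PosSemidef := by
  refine PosSemidef.of_dotProduct_mulVec_nonneg ?_ fun x => ?_
  · simpa [Matrix.IsHermitian] using hK
  · simpa [quad] using h x

theorem posSemidef_transpose_mul_mul {m l : ℕ} {K : Matrix (Fin m) (Fin m) ℝ} (hK : K.PosSemidef)
    (C : Matrix (Fin m) (Fin l) ℝ) : (Cᵀ * K * C).PosSemidef := by
  simpa using hK.conjTranspose_mul_mul_same C

/-- A positive definite form dominates a multiple of the squared norm. -/
theorem exists_le_quad {m : ℕ} {K : Matrix (Fin m) (Fin m) ℝ} (hK : K.PosDef) :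
    ∃ c : ℝ, 0 < c ∧ ∀ x, c * ‖x‖ ^ 2 ≤ quad K x := by
  have hpos : ∀ x, x ≠ 0 → 0 < quad K x := fun x hx => by
    simpa [quad] using hK.dotProduct_mulVec_pos hx
  have hsm : ∀ (a : ℝ) (x : Fin m → ℝ), quad K (a • x) = a ^ 2 * quad K x := fun a x => by
    simp only [quad, mulVec_smul, smul_dotProduct, dotProduct_smul, smul_eq_mul]; ring
  have hcont : Continuous (quad K) := by
    unfold quad; fun_prop
  -- The sphere is empty only for `m = 0`; every `x` is then zero and any constant serves.
  rcases (Metric.sphere (0 : Fin m → ℝ) 1).eq_empty_or_nonempty with he | hne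
  · refine ⟨1, one_pos, fun x => ?_⟩
    by_cases hx : x = 0
    · simp [hx, quad_zero]
    · exfalso
      have : (‖x‖⁻¹ • x) ∈ Metric.sphere (0 : Fin m → ℝ) 1 := by
        simp [norm_smul, norm_ne_zero_iff.2 hx]
      rw [he] at this
      exact this
  · obtain ⟨z, hz, hmin⟩ := (isCompact_sphere (0 : Fin m → ℝ) 1).exists_isMinOn hne
      hcont.continuousOn
    have hz0 : z ≠ 0 := by
      rintro rfl
      simp at hz
    refine ⟨quad K z, hpos z hz0, fun x => ?_⟩
    by_cases hx : x = 0
    · simp [hx, quad_zero]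
    · have hn : ‖x‖ ≠ 0 := norm_ne_zero_iff.2 hx
      have h1 : (‖x‖⁻¹ • x) ∈ Metric.sphere (0 : Fin m → ℝ) 1 := by
        simp [norm_smul, hn]
      have h2 : quad K z ≤ quad K (‖x‖⁻¹ • x) := hmin h1
      have h3 : x = ‖x‖ • (‖x‖⁻¹ • x) := by rw [smul_smul, mul_inv_cancel₀ hn, one_smul]
      rw [h3, hsm, ← h3, mul_comm]
      exact mul_le_mul_of_nonneg_left h2 (sq_nonneg _)

variable {n s : ℕ}

/-- The weight `R k + (B k)ᵀ K (B k)` of the control in the dynamic programming recursion. -/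
def ctrlWeight (S : Plant n s) (k : ℕ) (K : Matrix (Fin n) (Fin n) ℝ) : Matrix (Fin s) (Fin s) ℝ :=
  S.R k + (S.B k)ᵀ * K * S.B k

/-- The reduction of the cost-to-go by an undelayed optimal control. -/
def reduction (S : Plant n s) (k : ℕ) (K : Matrix (Fin n) (Fin n) ℝ) : Matrix (Fin n) (Fin n) ℝ :=
  (S.A k)ᵀ * K * S.B k * gainOf S k K

theorem ctrlWeight_posDef {S : Plant n s} {k : ℕ} {K : Matrix (Fin n) (Fin n) ℝ}
    (hR : (S.R k).PosDef) (hK : K.PosSemidef) : (ctrlWeight S k K).PosDef :=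
  hR.add_posSemidef (posSemidef_transpose_mul_mul hK _)

theorem ctrlWeight_mul_gainOf {S : Plant n s} {k : ℕ} {K : Matrix (Fin n) (Fin n) ℝ}
    (hR : (S.R k).PosDef) (hK : K.PosSemidef) :
    ctrlWeight S k K * gainOf S k K = (S.B k)ᵀ * K * S.A k := by
  have hu : IsUnit (ctrlWeight S k K).det :=
    (Matrix.isUnit_iff_isUnit_det _).1 (ctrlWeight_posDef hR hK).isUnit
  unfold gainOf
  change ctrlWeight S k K * ((ctrlWeight S k K)⁻¹ * (S.B k)ᵀ * K * S.A k) = _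
  simp only [Matrix.mul_assoc]
  rw [← Matrix.mul_assoc (ctrlWeight S k K), Matrix.mul_nonsing_inv _ hu, Matrix.one_mul]

/-- Transposing the normal equation `ctrlWeight_mul_gainOf` exhibits the reduction as a congruence
of a positive definite matrix, which makes its sign visible. -/
theorem reduction_eq {S : Plant n s} {k : ℕ} {K : Matrix (Fin n) (Fin n) ℝ}
    (hR : (S.R k).PosDef) (hK : K.PosSemidef) :
    reduction S k K = (gainOf S k K)ᵀ * ctrlWeight S k K * gainOf S k K := by
  have h := congrArg Matrix.transpose (ctrlWeight_mul_gainOf hR hK)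
  simp only [transpose_mul, transpose_transpose, transpose_eq_of_posSemidef hK,
    transpose_eq_of_posSemidef (ctrlWeight_posDef hR hK).posSemidef] at h
  rw [h, reduction, Matrix.mul_assoc (S.A k)ᵀ K]

theorem reduction_posSemidef {S : Plant n s} {k : ℕ} {K : Matrix (Fin n) (Fin n) ℝ}
    (hR : (S.R k).PosDef) (hK : K.PosSemidef) : (reduction S k K).PosSemidef := by
  rw [reduction_eq hR hK]
  exact posSemidef_transpose_mul_mul (ctrlWeight_posDef hR hK).posSemidef _

theorem quad_gainOf {S : Plant n s} {k : ℕ} {K : Matrix (Fin n) (Fin n) ℝ}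
    (hR : (S.R k).PosDef) (hK : K.PosSemidef) (x : Fin n → ℝ) :
    quad (ctrlWeight S k K) (gainOf S k K *ᵥ x) = quad (reduction S k K) x := by
  rw [quad_mulVec, reduction_eq hR hK]

/-- Completing the square in the one-step cost. -/
theorem stage_cost_eq {S : Plant n s} {k : ℕ} {K : Matrix (Fin n) (Fin n) ℝ}
    (hR : (S.R k).PosDef) (hK : K.PosSemidef) (x : Fin n → ℝ) (u : Fin s → ℝ) :
    quad (S.R k) u + quad K (S.A k *ᵥ x + S.B k *ᵥ u) =
      quad ((S.A k)ᵀ * K * S.A k) x - quad (reduction S k K) x +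
        quad (ctrlWeight S k K) (u + gainOf S k K *ᵥ x) := by
  have hS := transpose_eq_of_posSemidef (ctrlWeight_posDef hR hK).posSemidef
  have hKt := transpose_eq_of_posSemidef hK
  -- The cross term of the square is the cross term of the dynamics, by the normal equation.
  have e1 : u ⬝ᵥ (ctrlWeight S k K *ᵥ (gainOf S k K *ᵥ x)) =
      (S.B k *ᵥ u) ⬝ᵥ (K *ᵥ (S.A k *ᵥ x)) := by
    rw [mulVec_mulVec, ctrlWeight_mul_gainOf hR hK]
    simp only [← mulVec_mulVec]
    rw [dotProduct_mulVec u, vecMul_transpose]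
  have symm : ∀ {m : ℕ} {L : Matrix (Fin m) (Fin m) ℝ} (_ : Lᵀ = L) (a b : Fin m → ℝ),
      a ⬝ᵥ (L *ᵥ b) = b ⬝ᵥ (L *ᵥ a) := by
    intro m L hL a b
    rw [dotProduct_mulVec, ← mulVec_transpose, hL, dotProduct_comm]
  rw [quad_add, quad_add, symm hS (gainOf S k K *ᵥ x) u, e1, symm hKt (S.A k *ᵥ x), quad_gainOf hR hK,
    quad_mulVec, quad_mulVec, ctrlWeight, quad_matrix_add]
  ring

theorem riccati_top (S : Plant n s) (r : ℝ) : riccati S r S.N = S.Q S.N := by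
  simp [riccati, riccatiRev]

theorem riccati_step (S : Plant n s) (r : ℝ) {k : ℕ} (hk : k < S.N) :
    riccati S r k = riccatiStep S r k (riccati S r (k + 1)) := by
  obtain ⟨j, hj⟩ : ∃ j, S.N - k = j + 1 := ⟨S.N - k - 1, by omega⟩
  have h1 : S.N - (k + 1) = j := by omega
  have h2 : S.N - (j + 1) = k := by omega
  rw [riccati, riccati, hj, h1, riccatiRev, h2]

theorem quad_riccatiStep (S : Plant n s) (r : ℝ) (k : ℕ) (K : Matrix (Fin n) (Fin n) ℝ)
    (x : Fin n → ℝ) :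
    quad (riccatiStep S r k K) x = quad (S.Q k) x + quad ((S.A k)ᵀ * K * S.A k) x -
      if S.M ∣ k then r * quad (reduction S k K) x else 0 := by
  rw [riccatiStep, quad_matrix_sub, quad_matrix_add]
  split_ifs
  · rw [quad_matrix_smul]; rfl
  · simp [quad]

/-- The feedback `u = -V x` annihilates the square in `stage_cost_eq`, so `Aᵀ K A - Λ` is itself a
nonnegative cost; `r ≤ 1` subtracts no more than `Λ`. -/
theorem riccatiStep_posSemidef {S : Plant n s} {k : ℕ} {K : Matrix (Fin n) (Fin n) ℝ} {r : ℝ}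
    (hr0 : 0 ≤ r) (hr1 : r ≤ 1) (hQ : (S.Q k).PosSemidef) (hR : (S.R k).PosDef)
    (hK : K.PosSemidef) : (riccatiStep S r k K).PosSemidef := by
  have hL := hQ.add (posSemidef_transpose_mul_mul hK (S.A k))
  have hΛ := reduction_posSemidef hR hK
  refine posSemidef_of_quad_nonneg ?_ fun x => ?_
  · rw [riccatiStep, transpose_sub, transpose_eq_of_posSemidef hL]
    congr 1
    split_ifs
    · rw [transpose_smul]
      congr 1
      exact transpose_eq_of_posSemidef hΛ
    · simp
  · rw [quad_riccatiStep]
    have h0 := quad_nonneg hQ x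
    have h1 := quad_nonneg (posSemidef_transpose_mul_mul hK (S.A k)) x
    have h2 := quad_nonneg hΛ x
    have h3 := stage_cost_eq hR hK x (-(gainOf S k K *ᵥ x))
    rw [neg_add_cancel, quad_zero] at h3
    have h4 := quad_nonneg hK (S.A k *ᵥ x + S.B k *ᵥ -(gainOf S k K *ᵥ x))
    have h5 := quad_nonneg hR.posSemidef (-(gainOf S k K *ᵥ x))
    split_ifs
    · nlinarith
    · linarith

theorem riccati_posSemidef {S : Plant n s} {r : ℝ} (hr0 : 0 ≤ r) (hr1 : r ≤ 1)
    (hQ : ∀ k ≤ S.N, (S.Q k).PosSemidef) (hR : ∀ k < S.N, (S.R k).PosDef) {k : ℕ} (hk : k ≤ S.N) :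
    (riccati S r k).PosSemidef := by
  induction hk using Nat.decreasingInduction with
  | self => rw [riccati_top]; exact hQ _ le_rfl
  | of_succ k hk ih =>
    rw [riccati_step S r hk]
    exact riccatiStep_posSemidef hr0 hr1 (hQ k hk.le) (hR k hk) ih

end

/-! ### The path law of the endpoint. -/

section

/-- Probability of a path of the endpoint. -/
def pathProb (N : ℕ) (p q : ℝ) (τ₀ : Bool) (t : Fin (N + 1) → Bool) : ℝ :=
  if t 0 = τ₀ then ∏ k : Fin N, fogTrans p q (t k.castSucc) (t k.succ) else 0

theorem fogTrans_nonneg {p q : ℝ} (hp0 : 0 ≤ p) (hp1 : p ≤ 1) (hq0 : 0 ≤ q) (hq1 : q ≤ 1)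
    (b c : Bool) : 0 ≤ fogTrans p q b c := by
  cases b <;> cases c <;> simp [fogTrans] <;> linarith

theorem fogTrans_sum (p q : ℝ) (b : Bool) : fogTrans p q b true + fogTrans p q b false = 1 := by
  cases b <;> simp [fogTrans]

theorem pathProb_nonneg {p q : ℝ} (hp0 : 0 ≤ p) (hp1 : p ≤ 1) (hq0 : 0 ≤ q) (hq1 : q ≤ 1)
    {N : ℕ} (τ₀ : Bool) (t : Fin (N + 1) → Bool) : 0 ≤ pathProb N p q τ₀ t := by
  unfold pathProb
  split_ifs
  · exact Finset.prod_nonneg fun k _ => fogTrans_nonneg hp0 hp1 hq0 hq1 _ _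
  · exact le_rfl

/-- The Markov property in the form used here: the last state is summed out with a weight that
depends only on its predecessor, which stands in for conditional expectations. -/
theorem pathProb_snoc (N : ℕ) (p q : ℝ) (τ₀ : Bool) (t : Fin (N + 1) → Bool) (b : Bool) :
    pathProb (N + 1) p q τ₀ (Fin.snoc t b) =
      pathProb N p q τ₀ t * fogTrans p q (t (Fin.last N)) b := by
  have h0 : (Fin.snoc t b : Fin (N + 2) → Bool) 0 = t 0 :=
    Fin.snoc_castSucc (α := fun _ => Bool) b t 0
  unfold pathProb
  rw [h0]
  split_ifs
  · rw [Fin.prod_univ_castSucc]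
    congr 1
    · refine Finset.prod_congr rfl fun k _ => ?_
      rw [Fin.succ_castSucc, Fin.snoc_castSucc, Fin.snoc_castSucc]
    · rw [Fin.succ_last, Fin.snoc_last, Fin.snoc_castSucc]
  · simp

theorem sum_snoc (N : ℕ) (f : (Fin (N + 2) → Bool) → ℝ) :
    ∑ t, f t = ∑ t : Fin (N + 1) → Bool, (f (Fin.snoc t true) + f (Fin.snoc t false)) := by
  rw [← (Fin.snocEquiv fun _ => Bool).sum_comp, Fintype.sum_prod_type_right]
  simp [Fin.snocEquiv]

theorem extendPath_snoc {N : ℕ} (t : Fin (N + 1) → Bool) (b : Bool) {k : ℕ} (hk : k < N + 1) :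
    extendPath (Fin.snoc t b : Fin (N + 2) → Bool) k = extendPath t k := by
  have h : k < N + 1 + 1 := by omega
  rw [extendPath, dif_pos h, extendPath, dif_pos hk]
  exact Fin.snoc_castSucc (α := fun _ => Bool) b t ⟨k, hk⟩

theorem extendPath_snoc_last {N : ℕ} (t : Fin (N + 1) → Bool) (b : Bool) :
    extendPath (Fin.snoc t b : Fin (N + 2) → Bool) (N + 1) = b := by
  rw [extendPath, dif_pos (by omega)]
  exact Fin.snoc_last (α := fun _ => Bool) b t

theorem sum_pathProb (N : ℕ) (p q : ℝ) (τ₀ : Bool) : ∑ t, pathProb N p q τ₀ t = 1 := by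
  induction N with
  | zero =>
    have : ∑ t : Fin 1 → Bool, pathProb 0 p q τ₀ t = ∑ b : Bool, if b = τ₀ then (1 : ℝ) else 0 := by
      rw [← (Equiv.funUnique (Fin 1) Bool).symm.sum_comp]
      exact Finset.sum_congr rfl fun b _ => by simp [pathProb]
    rw [this]
    simp
  | succ N ih =>
    rw [sum_snoc, ← ih]
    refine Finset.sum_congr rfl fun t _ => ?_
    rw [pathProb_snoc, pathProb_snoc, ← mul_add, fogTrans_sum, mul_one]

/-- Indicator of the state ON. -/
def onInd (b : Bool) : ℝ := if b = true then 1 else 0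

/-- If the ON-probability never exceeds `r`, then, weighted by a nonnegative function of the past,
the mean of `r - 1_{τ j = ON}` is nonnegative. -/
theorem sum_pathProb_mul_nonneg {p q : ℝ} (hp0 : 0 ≤ p) (hp1 : p ≤ 1) (hq0 : 0 ≤ q) (hq1 : q ≤ 1)
    {N : ℕ} (τ₀ : Bool) {j : ℕ} (hj0 : 0 < j) (hjN : j ≤ N) {c r : ℝ}
    (hr : ∀ b, 0 ≤ c * (r - fogTrans p q b true))
    {g : (ℕ → Bool) → ℝ} (hg0 : ∀ τ, 0 ≤ g τ)
    (hg : ∀ τ τ', (∀ i < j, τ i = τ' i) → g τ = g τ') :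
    0 ≤ c * ∑ t, pathProb N p q τ₀ t * ((r - onInd (extendPath t j)) * g (extendPath t)) := by
  induction N with
  | zero => omega
  | succ N ih =>
    have hgs : ∀ (t : Fin (N + 1) → Bool) (b : Bool),
        g (extendPath (Fin.snoc t b : Fin (N + 2) → Bool)) = g (extendPath t) := fun t b =>
      hg _ _ fun i hi => extendPath_snoc t b (by omega)
    rw [sum_snoc]
    simp only [pathProb_snoc, hgs]
    -- Either `j` is the appended time, or the appended state sums out with total weight one.
    rcases Nat.lt_or_ge N j with h | h
    · obtain rfl : j = N + 1 := by omega
      simp only [extendPath_snoc_last]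
      rw [Finset.mul_sum]
      refine Finset.sum_nonneg fun t _ => ?_
      have e := fogTrans_sum p q (t (Fin.last N))
      -- Summing over the state at time `j` turns `r - 1_ON` into `r` minus the ON-probability given
      -- the previous state.
      have : c * (pathProb N p q τ₀ t * fogTrans p q (t (Fin.last N)) true *
            ((r - onInd true) * g (extendPath t)) +
          pathProb N p q τ₀ t * fogTrans p q (t (Fin.last N)) false *
            ((r - onInd false) * g (extendPath t))) =
          pathProb N p q τ₀ t * g (extendPath t) *
            (c * (r - fogTrans p q (t (Fin.last N)) true)) := by
        rw [eq_sub_of_add_eq' e]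
        simp only [onInd, if_true, Bool.false_eq_true, if_false]
        ring
      rw [this]
      exact mul_nonneg (mul_nonneg (pathProb_nonneg hp0 hp1 hq0 hq1 _ _) (hg0 _)) (hr _)
    · have e : ∀ (t : Fin (N + 1) → Bool) (b : Bool),
          extendPath (Fin.snoc t b : Fin (N + 2) → Bool) j = extendPath t j := fun t b =>
        extendPath_snoc t b (by omega)
      simp only [e]
      refine (ih h).trans_eq (congrArg _ (Finset.sum_congr rfl fun t _ => ?_))
      rw [← add_mul, ← mul_add, fogTrans_sum, mul_one]

theorem fogLaw_eq (N : ℕ) (p q : ℝ) (τ₀ : Bool) :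
    fogLaw N p q τ₀ = ∑ t : Fin (N + 1) → Bool,
      ENNReal.ofReal (pathProb N p q τ₀ t) • Measure.dirac t := rfl

variable {Ω : Type*} [MeasurableSpace Ω]

theorem lintegral_prod_fogLaw (μ : Measure Ω) [IsProbabilityMeasure μ] (N : ℕ) (p q : ℝ) (τ₀ : Bool)
    {f : Ω → (Fin (N + 1) → Bool) → ℝ≥0∞} (hf : ∀ t, Measurable fun ω => f ω t) :
    ∫⁻ z, f z.1 z.2 ∂(μ.prod (fogLaw N p q τ₀)) =
      ∑ t, ENNReal.ofReal (pathProb N p q τ₀ t) * ∫⁻ ω, f ω t ∂μ := by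
  have hfm : Measurable fun z : Ω × (Fin (N + 1) → Bool) => f z.1 z.2 :=
    measurable_from_prod_countable_left fun t => hf t
  have hfin : IsFiniteMeasure (fogLaw N p q τ₀) := by
    constructor
    rw [fogLaw_eq, Measure.finsetSum_apply]
    exact ENNReal.sum_lt_top.2 fun t _ => by simp
  rw [lintegral_prod_symm _ hfm.aemeasurable, fogLaw_eq, lintegral_finsetSum_measure]
  simp

end

/-! ### The closed loop: causality and prediction. -/

section

variable {n s : ℕ}

theorem run_fst (S : Plant n s) (π : Policy n s) (x₀ : Fin n → ℝ) (w : ℕ → Fin n → ℝ)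
    (τ : ℕ → Bool) (k : ℕ) :
    (run S π x₀ w τ k).1 = fun i => if i ≤ k then state S π x₀ w τ i else 0 := by
  induction k with
  | zero =>
    funext i
    by_cases hi : i = 0
    · subst hi; simp [state, run]
    · simp [run, hi]
  | succ k ih =>
    funext i
    rcases lt_trichotomy i (k + 1) with h | h | h
    · have : (run S π x₀ w τ (k + 1)).1 i = (run S π x₀ w τ k).1 i := by
        simp [run, Function.update_of_ne h.ne]
      rw [this, ih]
      simp [h.le, Nat.lt_succ_iff.1 h]
    · subst h; simp [state]
    · have : (run S π x₀ w τ (k + 1)).1 i = (run S π x₀ w τ k).1 i := by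
        simp [run, Function.update_of_ne h.ne']
      rw [this, ih]
      simp [show ¬ i ≤ k by omega, show ¬ i ≤ k + 1 by omega]

theorem run_snd (S : Plant n s) (π : Policy n s) (x₀ : Fin n → ℝ) (w : ℕ → Fin n → ℝ)
    (τ : ℕ → Bool) (k : ℕ) :
    (run S π x₀ w τ k).2 = fun i => if i < k then ctrl S π x₀ w τ i else 0 := by
  induction k with
  | zero => funext i; simp [run]
  | succ k ih =>
    funext i
    rcases lt_trichotomy i k with h | h | h
    · have : (run S π x₀ w τ (k + 1)).2 i = (run S π x₀ w τ k).2 i := by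
        simp [run, Function.update_of_ne h.ne]
      rw [this, ih]
      simp [h, show i < k + 1 by omega]
    · subst h; simp [ctrl]
    · have : (run S π x₀ w τ (k + 1)).2 i = (run S π x₀ w τ k).2 i := by
        simp [run, Function.update_of_ne h.ne']
      rw [this, ih]
      simp [show ¬ i < k by omega, show ¬ i < k + 1 by omega]

theorem received_congr (S : Plant n s) (τ : ℕ → Bool) (k : ℕ) {x x' : ℕ → Fin n → ℝ}
    (h : ∀ i ≤ k, x i = x' i) : received S τ k x = received S τ k x' := by
  funext i
  unfold received
  split_ifs with hi
  · rw [h i (by omega)]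
  · rfl

theorem ctrl_eq (S : Plant n s) (π : Policy n s) (x₀ : Fin n → ℝ) (w : ℕ → Fin n → ℝ)
    (τ : ℕ → Bool) (k : ℕ) :
    ctrl S π x₀ w τ k = π k (received S τ k (state S π x₀ w τ))
      (fun i => if i < k then ctrl S π x₀ w τ i else 0) (τ (k - S.MB)) := by
  have h : ctrl S π x₀ w τ k = π k (received S τ k (run S π x₀ w τ k).1) (run S π x₀ w τ k).2
      (τ (k - S.MB)) := by
    simp [ctrl, run]
  rw [h, run_snd, received_congr S τ k (x' := state S π x₀ w τ)]
  intro i hi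
  rw [run_fst]
  simp [hi]

theorem state_zero (S : Plant n s) (π : Policy n s) (x₀ : Fin n → ℝ) (w : ℕ → Fin n → ℝ)
    (τ : ℕ → Bool) : state S π x₀ w τ 0 = x₀ := by
  simp [state, run]

theorem state_succ (S : Plant n s) (π : Policy n s) (x₀ : Fin n → ℝ) (w : ℕ → Fin n → ℝ)
    (τ : ℕ → Bool) (k : ℕ) :
    state S π x₀ w τ (k + 1) =
      S.A k *ᵥ state S π x₀ w τ k + S.B k *ᵥ ctrl S π x₀ w τ k + w k := by
  simp [state, ctrl, run]

theorem ctrl_eq_zero {S : Plant n s} {π : Policy n s} (hπ : Feasible S π) (x₀ : Fin n → ℝ)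
    (w : ℕ → Fin n → ℝ) (τ : ℕ → Bool) {k : ℕ} (hk : k < S.N) (h : k = 0 ∨ ¬ S.M ∣ k) :
    ctrl S π x₀ w τ k = 0 := by
  rw [ctrl_eq]; exact hπ.spread k hk h _ _ _

theorem ctrl_eq_zero_of_off {S : Plant n s} {π : Policy n s} (hπ : Feasible S π) (x₀ : Fin n → ℝ)
    (w : ℕ → Fin n → ℝ) {τ : ℕ → Bool} {k : ℕ} (hk : k < S.N) (h : τ (k - S.MB) = false) :
    ctrl S π x₀ w τ k = 0 := by
  rw [ctrl_eq, h]; exact hπ.off k hk _ _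

theorem le_of_pos_of_dvd {S : Plant n s} {k : ℕ} (h : ¬ (k = 0 ∨ ¬ S.M ∣ k)) : S.M ≤ k := by
  simp only [not_or, not_not] at h
  exact Nat.le_of_dvd (Nat.pos_of_ne_zero h.1) h.2

/-- The state at time `k` depends on the endpoint states up to time `k - MB` only. -/
theorem state_ctrl_congr {S : Plant n s} {π : Policy n s} (hπ : Feasible S π) (x₀ : Fin n → ℝ)
    (w : ℕ → Fin n → ℝ) {τ τ' : ℕ → Bool} (k : ℕ) (hk : k < S.N)
    (h : ∀ j, j + S.MB ≤ k → τ j = τ' j) :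
    state S π x₀ w τ k = state S π x₀ w τ' k ∧ ctrl S π x₀ w τ k = ctrl S π x₀ w τ' k := by
  induction k using Nat.strong_induction_on with
  | _ k ih =>
    have hlt : ∀ i < k, state S π x₀ w τ i = state S π x₀ w τ' i ∧
        ctrl S π x₀ w τ i = ctrl S π x₀ w τ' i := fun i hi =>
      ih i hi (by omega) fun j hj => h j (by omega)
    have hst : state S π x₀ w τ k = state S π x₀ w τ' k := by
      cases k with
      | zero => simp [state_zero]
      | succ k => rw [state_succ, state_succ, (hlt k (by omega)).1, (hlt k (by omega)).2]
    refine ⟨hst, ?_⟩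
    by_cases hz : k = 0 ∨ ¬ S.M ∣ k
    · rw [ctrl_eq_zero hπ x₀ w τ hk hz, ctrl_eq_zero hπ x₀ w τ' hk hz]
    -- At a control time `MB ≤ M ≤ k`, so `k - MB` is not truncated and the hypothesis covers the
    -- endpoint state read there.
    · have hle := le_of_pos_of_dvd hz
      have hMB : S.MB ≤ S.M := by simp [Plant.M]
      have hMF : S.M = S.MF + S.MB := rfl
      rw [ctrl_eq, ctrl_eq S π x₀ w τ', h (k - S.MB) (by omega)]
      congr 1
      · funext i
        unfold received
        by_cases hi : i + S.M ≤ k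
        · rw [h (i + S.MF) (by omega)]
          have : state S π x₀ w τ i = state S π x₀ w τ' i := by
            rcases (show i ≤ k by omega).lt_or_eq with hik | rfl
            · exact (hlt i hik).1
            · exact hst
          rw [this]
        · simp [hi]
      · funext i
        split_ifs with hi
        · rw [(hlt i hi).2]
        · rfl

/-- The contribution of the noise to `drift`. -/
def driftNoise (S : Plant n s) (w : ℕ → Fin n → ℝ) (i j : ℕ) : Fin n → ℝ := drift S w i 0 0 j

/-- Superposition: the prediction error depends on the disturbances alone, so no policy can
influence it. -/
theorem drift_eq (S : Plant n s) (w : ℕ → Fin n → ℝ) (i : ℕ) (x : Fin n → ℝ) (u : Fin s → ℝ)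
    (j : ℕ) : drift S w i x u j = drift S 0 i x u j + driftNoise S w i j := by
  induction j with
  | zero => simp [drift, driftNoise]
  | succ j ih =>
    simp only [driftNoise] at ih ⊢
    rw [drift, ih, drift, drift, mulVec_add]
    split_ifs
    · simp only [mulVec_zero, Pi.zero_apply]; abel
    · simp only [Pi.zero_apply]; abel

theorem driftNoise_succ (S : Plant n s) (w : ℕ → Fin n → ℝ) (i j : ℕ) :
    driftNoise S w i (j + 1) = S.A (i + j) *ᵥ driftNoise S w i j + w (i + j) := by
  simp [driftNoise, drift]

theorem state_add_eq_drift {S : Plant n s} {π : Policy n s} (hπ : Feasible S π) (x₀ : Fin n → ℝ)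
    (w : ℕ → Fin n → ℝ) (τ : ℕ → Bool) {i : ℕ} (hi : S.M ∣ i) {j : ℕ} (hj : j ≤ S.M)
    (hij : i + j ≤ S.N) :
    state S π x₀ w τ (i + j) = drift S w i (state S π x₀ w τ i) (ctrl S π x₀ w τ i) j := by
  induction j with
  | zero => simp [drift]
  | succ j ih =>
    rw [← add_assoc, state_succ, drift, ih (by omega) (by omega)]
    congr 2
    split_ifs with h
    · subst h; rfl
    -- Since `0 < j < M`, no control arrives strictly between consecutive multiples of `M`.
    · have hnd : ¬ S.M ∣ i + j := fun hd =>
        absurd (Nat.le_of_dvd (Nat.pos_of_ne_zero h) ((Nat.dvd_add_right hi).1 hd)) (by omega)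
      rw [ctrl_eq_zero hπ x₀ w τ (by omega) (Or.inr hnd), mulVec_zero]

/-- The prediction of the state at time `k` from the state and the control at time `k - M`. -/
def predState (S : Plant n s) (π : Policy n s) (x₀ : Fin n → ℝ) (w : ℕ → Fin n → ℝ) (τ : ℕ → Bool)
    (k : ℕ) : Fin n → ℝ :=
  drift S 0 (k - S.M) (state S π x₀ w τ (k - S.M)) (ctrl S π x₀ w τ (k - S.M)) S.M

theorem state_eq_predState_add {S : Plant n s} {π : Policy n s} (hπ : Feasible S π)
    (x₀ : Fin n → ℝ) (w : ℕ → Fin n → ℝ) (τ : ℕ → Bool) {k : ℕ} (hk : k ≤ S.N) (hMk : S.M ≤ k)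
    (hd : S.M ∣ k) :
    state S π x₀ w τ k = predState S π x₀ w τ k + driftNoise S w (k - S.M) S.M := by
  have h := state_add_eq_drift hπ x₀ w τ (i := k - S.M) (j := S.M)
    (Nat.dvd_sub hd dvd_rfl) le_rfl (by omega)
  rw [Nat.sub_add_cancel hMk] at h
  rw [h, drift_eq]; rfl

/-! ### Information available through the delay. -/

section Measurability

variable {Ω : Type*}

theorem measurable_mulVec {m l : ℕ} (C : Matrix (Fin m) (Fin l) ℝ) :
    Measurable fun x : Fin l → ℝ => C *ᵥ x := by
  have : Continuous fun x : Fin l → ℝ => C *ᵥ x := by fun_prop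
  exact this.measurable

theorem measurable_drift_zero (S : Plant n s) (i j : ℕ) :
    Measurable fun z : (Fin n → ℝ) × (Fin s → ℝ) => drift S 0 i z.1 z.2 j := by
  induction j with
  | zero => exact measurable_fst
  | succ j ih =>
    simp only [drift]
    refine Measurable.add (Measurable.add ((measurable_mulVec _).comp ih) ?_) measurable_const
    split_ifs
    · exact (measurable_mulVec _).comp measurable_snd
    · exact measurable_const

/-- The information generated by the disturbances before time `k`. -/
@[reducible] def past (S : Plant n s) (w : ℕ → Ω → Fin n → ℝ) (k : ℕ) : MeasurableSpace Ω :=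
  ⨆ i ∈ {i : Fin S.N | i.1 < k}, MeasurableSpace.comap (w i) inferInstance

/-- The information generated by the disturbances from time `k` on. -/
@[reducible] def future (S : Plant n s) (w : ℕ → Ω → Fin n → ℝ) (k : ℕ) : MeasurableSpace Ω :=
  ⨆ i ∈ {i : Fin S.N | k ≤ i.1}, MeasurableSpace.comap (w i) inferInstance

theorem past_mono (S : Plant n s) (w : ℕ → Ω → Fin n → ℝ) {k l : ℕ} (h : k ≤ l) :
    past S w k ≤ past S w l :=
  biSup_mono fun i (hi : i.1 < k) => lt_of_lt_of_le hi h

theorem measurable_past (S : Plant n s) (w : ℕ → Ω → Fin n → ℝ) {i k : ℕ} (hi : i < k)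
    (hN : i < S.N) : Measurable[past S w k] (w i) := by
  have h : MeasurableSpace.comap (w i) inferInstance ≤ past S w k :=
    le_iSup₂_of_le (f := fun (i : Fin S.N) (_ : i ∈ {i : Fin S.N | i.1 < k}) =>
      MeasurableSpace.comap (w i) inferInstance) ⟨i, hN⟩ hi le_rfl
  exact (comap_measurable (w i)).mono h le_rfl

theorem measurable_future (S : Plant n s) (w : ℕ → Ω → Fin n → ℝ) {i k : ℕ} (hi : k ≤ i)
    (hN : i < S.N) : Measurable[future S w k] (w i) := by
  have h : MeasurableSpace.comap (w i) inferInstance ≤ future S w k :=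
    le_iSup₂_of_le (f := fun (i : Fin S.N) (_ : i ∈ {i : Fin S.N | k ≤ i.1}) =>
      MeasurableSpace.comap (w i) inferInstance) ⟨i, hN⟩ hi le_rfl
  exact (comap_measurable (w i)).mono h le_rfl

theorem measurable_driftNoise (S : Plant n s) (w : ℕ → Ω → Fin n → ℝ) {i j : ℕ}
    (h : i + j ≤ S.N) :
    Measurable[future S w i] fun ω => driftNoise S (fun l => w l ω) i j := by
  induction j with
  | zero => exact measurable_const
  | succ j ih =>
    simp only [driftNoise_succ]
    exact ((measurable_mulVec _).comp (ih (by omega))).add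
      (measurable_future S w (by omega) (by omega))

/-- The delay expressed by σ-algebras, for a fixed endpoint path: usable measurements stop at time
`k - M`, and earlier nonzero controls sit at multiples of `M`, hence also at times at most `k - M`.
-/
theorem measurable_state_ctrl {S : Plant n s} {π : Policy n s} (hπ : Feasible S π) (hM : 1 ≤ S.M)
    (x₀ : Fin n → ℝ) (w : ℕ → Ω → Fin n → ℝ) (τ : ℕ → Bool) (k : ℕ) (hk : k ≤ S.N) :
    Measurable[past S w k] (fun ω => state S π x₀ (fun l => w l ω) τ k) ∧
      (k < S.N → Measurable[past S w (k - S.M)] fun ω => ctrl S π x₀ (fun l => w l ω) τ k) := by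
  induction k using Nat.strong_induction_on with
  | _ k ih =>
    constructor
    · cases k with
      | zero => simp only [state_zero]; exact measurable_const
      | succ k =>
        simp only [state_succ]
        have h := ih k (by omega) (by omega)
        refine (((measurable_mulVec _).comp (h.1.mono (past_mono S w (by omega)) le_rfl)).add
          ((measurable_mulVec _).comp
            ((h.2 (by omega)).mono (past_mono S w (by omega)) le_rfl))).add
          (measurable_past S w (by omega) (by omega))
    · intro hkN
      by_cases hz : k = 0 ∨ ¬ S.M ∣ k
      · simp only [ctrl_eq_zero hπ x₀ _ τ hkN hz]; exact measurable_const
      · have hle := le_of_pos_of_dvd hz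
        simp only [not_or, not_not] at hz
        simp only [ctrl_eq S π x₀ _ τ k]
        let _ : MeasurableSpace Ω := past S w (k - S.M)
        have hc := hπ.measurable k hkN
        have h1 : Measurable fun ω => received S τ k (state S π x₀ (fun l => w l ω) τ) := by
          refine measurable_pi_lambda _ fun i => ?_
          by_cases hi : i + S.M ≤ k ∧ τ (i + S.MF) = true
          · simp only [received, if_pos hi]
            exact measurable_const.prodMk ((ih i (by omega) (by omega)).1.mono
              (past_mono S w (by omega)) le_rfl)
          · simp only [received, if_neg hi]
            exact measurable_const
        have h2 : Measurable fun ω => fun i =>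
            if i < k then ctrl S π x₀ (fun l => w l ω) τ i else 0 := by
          refine measurable_pi_lambda _ fun i => ?_
          by_cases hi : i < k
          · simp only [if_pos hi]
            by_cases hzi : i = 0 ∨ ¬ S.M ∣ i
            · simp only [ctrl_eq_zero hπ x₀ _ τ (hi.trans hkN) hzi]; exact measurable_const
            · have hd : S.M ∣ k - i := Nat.dvd_sub hz.2 (by simpa using (not_or.1 hzi).2)
              have := Nat.le_of_dvd (by omega) hd
              exact ((ih i hi (by omega)).2 (by omega)).mono (past_mono S w (by omega)) le_rfl
          · simp only [if_neg hi]
            exact measurable_const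
        exact hc.comp (h1.prodMk (h2.prodMk measurable_const))

theorem measurable_predState {S : Plant n s} {π : Policy n s} (hπ : Feasible S π) (hM : 1 ≤ S.M)
    (x₀ : Fin n → ℝ) (w : ℕ → Ω → Fin n → ℝ) (τ : ℕ → Bool) {k : ℕ} (hk : k < S.N) :
    Measurable[past S w (k - S.M)] (fun ω => predState S π x₀ (fun l => w l ω) τ k) := by
  have h := measurable_state_ctrl hπ hM x₀ w τ (k - S.M) (by omega)
  have hu := (h.2 (by omega)).mono (past_mono S w (Nat.sub_le _ _)) le_rfl
  let _ : MeasurableSpace Ω := past S w (k - S.M)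
  exact (measurable_drift_zero S (k - S.M) S.M).comp (h.1.prodMk hu)

end Measurability

end

/-! ### Second moments and independence of the disturbances. -/

section

variable {n s : ℕ} {Ω : Type*} [MeasurableSpace Ω] {μ : Measure Ω}

theorem MemLp.mulVec {m l : ℕ} {f : Ω → Fin l → ℝ} {p : ℝ≥0∞} (hf : MemLp f p μ)
    (C : Matrix (Fin m) (Fin l) ℝ) : MemLp (fun ω => C *ᵥ f ω) p μ :=
  (LinearMap.toContinuousLinearMap C.mulVecLin).comp_memLp' hf

theorem integral_mulVec {m l : ℕ} {f : Ω → Fin l → ℝ} (hf : Integrable f μ)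
    (C : Matrix (Fin m) (Fin l) ℝ) : ∫ ω, C *ᵥ f ω ∂μ = C *ᵥ ∫ ω, f ω ∂μ :=
  (LinearMap.toContinuousLinearMap C.mulVecLin).integral_comp_comm hf

theorem integrable_dotProduct {m : ℕ} {f g : Ω → Fin m → ℝ} (hf : MemLp f 2 μ) (hg : MemLp g 2 μ) :
    Integrable (fun ω => f ω ⬝ᵥ g ω) μ :=
  integrable_finsetSum _ fun i _ => (hf.eval i).integrable_mul (hg.eval i)

theorem integrable_quad {m : ℕ} {f : Ω → Fin m → ℝ} (hf : MemLp f 2 μ)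
    (K : Matrix (Fin m) (Fin m) ℝ) : Integrable (fun ω => quad K (f ω)) μ :=
  integrable_dotProduct hf (MemLp.mulVec hf K)

/-- Independent square integrable vectors, one of them centered, are orthogonal. -/
theorem integral_dotProduct_eq_zero [IsProbabilityMeasure μ] {m : ℕ} {f g : Ω → Fin m → ℝ}
    (hf : MemLp f 2 μ) (hg : MemLp g 2 μ) (hfg : IndepFun f g μ) (h0 : ∫ ω, g ω ∂μ = 0) :
    ∫ ω, f ω ⬝ᵥ g ω ∂μ = 0 := by
  simp only [dotProduct]
  have hint : ∀ i ∈ Finset.univ, Integrable (fun ω => f ω i * g ω i) μ :=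
    fun i _ => (hf.eval i).integrable_mul (hg.eval i)
  rw [integral_finsetSum _ hint]
  refine Finset.sum_eq_zero fun i _ => ?_
  have hi : IndepFun (fun ω => f ω i) (fun ω => g ω i) μ :=
    hfg.comp (measurable_pi_apply i) (measurable_pi_apply i)
  rw [hi.integral_fun_mul_eq_mul_integral (hf.eval i).aestronglyMeasurable
    (hg.eval i).aestronglyMeasurable]
  have : ∫ ω, g ω i ∂μ = 0 := by
    rw [← eval_integral fun i => (hg.eval i).integrable (by norm_num), h0]; rfl
  rw [this, mul_zero]

/-- Pythagoras: independence and centering remove the cross terms. There are two of them because `K`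
need not be symmetric. -/
theorem integral_quad_add [IsProbabilityMeasure μ] {m : ℕ} {f g : Ω → Fin m → ℝ}
    (hf : MemLp f 2 μ) (hg : MemLp g 2 μ) (hfg : IndepFun f g μ) (h0 : ∫ ω, g ω ∂μ = 0)
    (K : Matrix (Fin m) (Fin m) ℝ) :
    ∫ ω, quad K (f ω + g ω) ∂μ = ∫ ω, quad K (f ω) ∂μ + ∫ ω, quad K (g ω) ∂μ := by
  have hgi : Integrable g μ := hg.integrable (by norm_num)
  have e1 : ∫ ω, f ω ⬝ᵥ (K *ᵥ g ω) ∂μ = 0 :=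
    integral_dotProduct_eq_zero hf (MemLp.mulVec hg K)
      (hfg.comp measurable_id (measurable_mulVec K))
      (by rw [integral_mulVec hgi, h0, mulVec_zero])
  have e2 : ∫ ω, g ω ⬝ᵥ (K *ᵥ f ω) ∂μ = 0 := by
    simp only [fun ω => dotProduct_comm (g ω) (K *ᵥ f ω)]
    exact integral_dotProduct_eq_zero (MemLp.mulVec hf K) hg
      (hfg.comp (measurable_mulVec K) measurable_id) h0
  have i1 := integrable_dotProduct hf (MemLp.mulVec hg K)
  have i2 := integrable_dotProduct hg (MemLp.mulVec hf K)
  have i3 : Integrable (fun ω => f ω ⬝ᵥ (K *ᵥ g ω) + g ω ⬝ᵥ (K *ᵥ f ω)) μ := i1.add i2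
  have i4 : Integrable (fun ω => quad K (f ω) + quad K (g ω)) μ :=
    (integrable_quad hf K).add (integrable_quad hg K)
  simp only [quad_add]
  rw [integral_add i4 i3,
    integral_add (integrable_quad hf K) (integrable_quad hg K), integral_add i1 i2, e1, e2]
  ring

/-- Square integrability from integrability of a positive definite form. -/
theorem memLp_two_of_integrable_quad {m : ℕ} {f : Ω → Fin m → ℝ} (hf : AEStronglyMeasurable f μ)
    {K : Matrix (Fin m) (Fin m) ℝ} (hK : K.PosDef) (h : Integrable (fun ω => quad K (f ω)) μ) :
    MemLp f 2 μ := by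
  obtain ⟨c, hc, hle⟩ := exists_le_quad hK
  rw [memLp_two_iff_integrable_sq_norm hf]
  refine (h.const_mul c⁻¹).mono' (hf.norm.pow 2) (Filter.Eventually.of_forall fun ω => ?_)
  rw [Real.norm_of_nonneg (sq_nonneg _), ← div_eq_inv_mul, le_div_iff₀ hc, mul_comm]
  exact hle _

/-- Assumptions on the disturbances. -/
structure Noise (S : Plant n s) (μ : Measure Ω) (w : ℕ → Ω → Fin n → ℝ) : Prop where
  meas : ∀ k < S.N, Measurable (w k)
  memLp : ∀ k < S.N, MemLp (w k) 2 μ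
  mean : ∀ k < S.N, ∫ ω, w k ω ∂μ = 0
  indep : iIndepFun (fun k : Fin S.N => w k) μ

namespace Noise

variable {S : Plant n s} {w : ℕ → Ω → Fin n → ℝ}

theorem past_le (hw : Noise S μ w) (k : ℕ) : past S w k ≤ ‹MeasurableSpace Ω› :=
  iSup₂_le fun (i : Fin S.N) _ => (hw.meas i i.2).comap_le

theorem indep_past_future (hw : Noise S μ w) (k : ℕ) : Indep (past S w k) (future S w k) μ := by
  refine indep_iSup_of_disjoint (fun i : Fin S.N => (hw.meas i i.2).comap_le) hw.indep ?_
  rw [Set.disjoint_left]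
  intro i (h1 : i.1 < k) (h2 : k ≤ i.1)
  omega

theorem indepFun {m l : ℕ} (hw : Noise S μ w) {k : ℕ} {f : Ω → Fin m → ℝ} {g : Ω → Fin l → ℝ}
    (hf : Measurable[past S w k] f) (hg : Measurable[future S w k] g) : IndepFun f g μ :=
  indep_of_indep_of_le_left (indep_of_indep_of_le_right (hw.indep_past_future k) hg.comap_le)
    hf.comap_le

theorem memLp_driftNoise (hw : Noise S μ w) {i j : ℕ} (h : i + j ≤ S.N) :
    MemLp (fun ω => driftNoise S (fun l => w l ω) i j) 2 μ := by
  induction j with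
  | zero => exact MemLp.zero
  | succ j ih =>
    simp only [driftNoise_succ]
    exact (MemLp.mulVec (ih (by omega)) _).add (hw.memLp _ (by omega))

theorem integral_driftNoise [IsProbabilityMeasure μ] (hw : Noise S μ w) {i j : ℕ}
    (h : i + j ≤ S.N) :
    ∫ ω, driftNoise S (fun l => w l ω) i j ∂μ = 0 := by
  induction j with
  | zero => exact integral_zero _ _
  | succ j ih =>
    simp only [driftNoise_succ]
    have h1 := (hw.memLp_driftNoise (i := i) (j := j) (by omega))
    rw [integral_add ((MemLp.mulVec h1 _).integrable (by norm_num))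
      ((hw.memLp (i + j) (by omega)).integrable (by norm_num)),
      integral_mulVec (h1.integrable (by norm_num)), ih (by omega), mulVec_zero,
      hw.mean _ (by omega), add_zero]

theorem predict_eq [IsProbabilityMeasure μ] (hw : Noise S μ w) {k : ℕ} (hk : k ≤ S.N)
    (hMk : S.M ≤ k) (x : Fin n → ℝ) (u : Fin s → ℝ) :
    predict S μ w k x u = drift S 0 (k - S.M) x u S.M := by
  have h : k - S.M + S.M ≤ S.N := by omega
  unfold predict
  simp only [drift_eq S (fun l => w l _)]
  rw [integral_add (integrable_const _) ((hw.memLp_driftNoise h).integrable (by norm_num)),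
    hw.integral_driftNoise h]
  simp

end Noise

variable {S : Plant n s} {w : ℕ → Ω → Fin n → ℝ} {π : Policy n s} {τ : ℕ → Bool}
  {x₀ : Fin n → ℝ}

theorem memLp_drift_zero [IsProbabilityMeasure μ] {x : Ω → Fin n → ℝ} {u : Ω → Fin s → ℝ}
    (hx : MemLp x 2 μ) (hu : MemLp u 2 μ) (i j : ℕ) :
    MemLp (fun ω => drift S 0 i (x ω) (u ω) j) 2 μ := by
  induction j with
  | zero => exact hx
  | succ j ih =>
    simp only [drift]
    refine ((MemLp.mulVec ih _).add ?_).add (memLp_const _)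
    split_ifs
    · exact MemLp.mulVec hu _
    · exact memLp_const _

theorem memLp_state [IsProbabilityMeasure μ] (hw : Noise S μ w) {k : ℕ} (hk : k ≤ S.N)
    (hu : ∀ i < k, MemLp (fun ω => ctrl S π x₀ (fun l => w l ω) τ i) 2 μ) :
    MemLp (fun ω => state S π x₀ (fun l => w l ω) τ k) 2 μ := by
  induction k with
  | zero => simp only [state_zero]; exact memLp_const _
  | succ k ih =>
    simp only [state_succ]
    exact ((MemLp.mulVec (ih (by omega) fun i hi => hu i (by omega)) _).add
      (MemLp.mulVec (hu k (by omega)) _)).add (hw.memLp k (by omega))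

theorem measurable_state (hw : Noise S μ w) (hπ : Feasible S π) (hM : 1 ≤ S.M) {k : ℕ}
    (hk : k ≤ S.N) : Measurable fun ω => state S π x₀ (fun l => w l ω) τ k :=
  (measurable_state_ctrl hπ hM x₀ w τ k hk).1.mono (hw.past_le k) le_rfl

theorem measurable_ctrl (hw : Noise S μ w) (hπ : Feasible S π) (hM : 1 ≤ S.M) {k : ℕ}
    (hk : k < S.N) : Measurable fun ω => ctrl S π x₀ (fun l => w l ω) τ k :=
  ((measurable_state_ctrl hπ hM x₀ w τ k hk.le).2 hk).mono (hw.past_le _) le_rfl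

end

/-! ### The exact mean cost along a fixed endpoint path. -/

section

variable {n s : ℕ} {Ω : Type*} [MeasurableSpace Ω]

/-- The part of the cost caused by the disturbance `w k` and, at the control times, by the part of
the state that cannot be predicted. -/
def noiseCost (S : Plant n s) (μ : Measure Ω) (w : ℕ → Ω → Fin n → ℝ) (x₀ : Fin n → ℝ) (r : ℝ)
    (k : ℕ) : ℝ :=
  ∫ ω, quad (riccati S r (k + 1)) (w k ω) ∂μ +
    if k = 0 then r * quad (reduction S k (riccati S r (k + 1))) x₀
    else if S.M ∣ k then r * ∫ ω, quad (reduction S k (riccati S r (k + 1)))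
      (driftNoise S (fun l => w l ω) (k - S.M) S.M) ∂μ
    else 0

/-- Mean reduction of the cost by a control computed from the predicted state. -/
def predReduction (S : Plant n s) (μ : Measure Ω) (w : ℕ → Ω → Fin n → ℝ) (x₀ : Fin n → ℝ) (r : ℝ)
    (π : Policy n s) (k : ℕ) (τ : ℕ → Bool) : ℝ :=
  ∫ ω, quad (reduction S k (riccati S r (k + 1))) (predState S π x₀ (fun l => w l ω) τ k) ∂μ

/-- Mean cost of deviating from the optimal feedback on the predicted state. -/
def deviation (S : Plant n s) (μ : Measure Ω) (w : ℕ → Ω → Fin n → ℝ) (x₀ : Fin n → ℝ) (r : ℝ)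
    (π : Policy n s) (k : ℕ) (τ : ℕ → Bool) : ℝ :=
  ∫ ω, quad (ctrlWeight S k (riccati S r (k + 1))) (ctrl S π x₀ (fun l => w l ω) τ k +
    gainOf S k (riccati S r (k + 1)) *ᵥ predState S π x₀ (fun l => w l ω) τ k) ∂μ

/-- The policy-dependent part of the mean cost at time `k`. -/
def policyCost (S : Plant n s) (μ : Measure Ω) (w : ℕ → Ω → Fin n → ℝ) (x₀ : Fin n → ℝ) (r : ℝ)
    (π : Policy n s) (k : ℕ) (τ : ℕ → Bool) : ℝ :=
  if 0 < k ∧ S.M ∣ k then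
    onInd (τ (k - S.MB)) * deviation S μ w x₀ r π k τ +
      (r - onInd (τ (k - S.MB))) * predReduction S μ w x₀ r π k τ
  else 0

theorem stage_eq {S : Plant n s} {r : ℝ} {k : ℕ} {K : Matrix (Fin n) (Fin n) ℝ}
    (hR : (S.R k).PosDef) (hK : K.PosSemidef) (x : Fin n → ℝ) (u : Fin s → ℝ) :
    quad (S.Q k) x + quad (S.R k) u + quad K (S.A k *ᵥ x + S.B k *ᵥ u) -
        quad (riccatiStep S r k K) x =
      (if S.M ∣ k then r * quad (reduction S k K) x else 0) - quad (reduction S k K) x +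
        quad (ctrlWeight S k K) (u + gainOf S k K *ᵥ x) := by
  rw [quad_riccatiStep]
  linarith [stage_cost_eq hR hK x u]

variable {S : Plant n s} {μ : Measure Ω} [IsProbabilityMeasure μ] {w : ℕ → Ω → Fin n → ℝ}
  {π : Policy n s} {τ : ℕ → Bool} {x₀ : Fin n → ℝ}

theorem memLp_predState (hw : Noise S μ w) {k : ℕ} (hk : k < S.N)
    (hu : ∀ i < S.N, MemLp (fun ω => ctrl S π x₀ (fun l => w l ω) τ i) 2 μ) :
    MemLp (fun ω => predState S π x₀ (fun l => w l ω) τ k) 2 μ :=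
  memLp_drift_zero (memLp_state hw (by omega) fun i hi => hu i (by omega)) (hu _ (by omega)) _ _

/-- Mean one-step cost, relative to the quadratic value function. -/
theorem integral_stage (hw : Noise S μ w) (hπ : Feasible S π) (hM : 1 ≤ S.M) {r : ℝ} {k : ℕ}
    (hk : k < S.N) (hR : (S.R k).PosDef) (hK : (riccati S r (k + 1)).PosSemidef)
    (hu : ∀ i < S.N, MemLp (fun ω => ctrl S π x₀ (fun l => w l ω) τ i) 2 μ) :
    ∫ ω, (quad (S.Q k) (state S π x₀ (fun l => w l ω) τ k) +
        quad (S.R k) (ctrl S π x₀ (fun l => w l ω) τ k) +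
        quad (riccati S r (k + 1)) (S.A k *ᵥ state S π x₀ (fun l => w l ω) τ k +
          S.B k *ᵥ ctrl S π x₀ (fun l => w l ω) τ k) -
        quad (riccati S r k) (state S π x₀ (fun l => w l ω) τ k)) ∂μ +
      ∫ ω, quad (riccati S r (k + 1)) (w k ω) ∂μ =
      noiseCost S μ w x₀ r k + policyCost S μ w x₀ r π k τ := by
  rw [noiseCost, policyCost]
  simp only [riccati_step S r hk, stage_eq hR hK]
  set K := riccati S r (k + 1) with hKdef
  rw [add_comm, add_assoc]
  congr 1
  by_cases hz : k = 0 ∨ ¬ S.M ∣ k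
  -- Since `M ∣ 0`, the Riccati step subtracts `r Λ` at time `0`, although no control can arrive
  -- then; the `k = 0` term of `noiseCost` restores it.
  · simp only [ctrl_eq_zero hπ x₀ _ τ hk hz, zero_add, quad_gainOf hR hK, sub_add_cancel]
    by_cases h0 : k = 0
    · subst h0
      simp [state_zero]
    · have hnd : ¬ S.M ∣ k := hz.resolve_left h0
      simp [h0, hnd]
  · have hMk := le_of_pos_of_dvd hz
    obtain ⟨h0, hd⟩ : k ≠ 0 ∧ S.M ∣ k := by simpa using hz
    have hij : k - S.M + S.M ≤ S.N := by omega
    rw [if_neg h0, if_pos hd, if_pos ⟨Nat.pos_of_ne_zero h0, hd⟩]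
    simp only [if_pos hd]
    have hp := memLp_predState (k := k) hw hk hu
    have he := hw.memLp_driftNoise hij
    have he0 := hw.integral_driftNoise hij
    have hpm := measurable_predState hπ hM x₀ w τ hk
    have hem := measurable_driftNoise S w hij
    have hind := hw.indepFun hpm hem
    -- The prediction uses disturbances before `k - M`, the error those from `k - M` on.
    have hpyth : ∀ L : Matrix (Fin n) (Fin n) ℝ,
        ∫ ω, quad L (state S π x₀ (fun l => w l ω) τ k) ∂μ =
        ∫ ω, quad L (predState S π x₀ (fun l => w l ω) τ k) ∂μ +
        ∫ ω, quad L (driftNoise S (fun l => w l ω) (k - S.M) S.M) ∂μ := fun L => by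
      simp only [fun ω => state_eq_predState_add hπ x₀ (fun l => w l ω) τ hk.le hMk hd]
      exact integral_quad_add hp he hind he0 L
    have hx : MemLp (fun ω => state S π x₀ (fun l => w l ω) τ k) 2 μ :=
      memLp_state hw hk.le fun i hi => hu i (by omega)
    -- When OFF, the zero control leaves `r` times the prediction and error reductions. When ON,
    -- `-Λ` acts on both parts, and the square gives back the error part and the deviation.
    cases hτ : τ (k - S.MB) with
    | false =>
      simp only [ctrl_eq_zero_of_off hπ x₀ _ hk hτ, zero_add, quad_gainOf hR hK, sub_add_cancel]
      rw [integral_const_mul, hpyth]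
      simp only [onInd, predReduction, Bool.false_eq_true, if_false, zero_mul, sub_zero]
      ring
    | true =>
      have hv : MemLp (fun ω => ctrl S π x₀ (fun l => w l ω) τ k +
          gainOf S k K *ᵥ predState S π x₀ (fun l => w l ω) τ k) 2 μ :=
        (hu k hk).add (MemLp.mulVec hp _)
      have hg : MemLp (fun ω => gainOf S k K *ᵥ driftNoise S (fun l => w l ω) (k - S.M) S.M) 2 μ :=
        MemLp.mulVec he _
      have hvm : Measurable[past S w (k - S.M)] fun ω => ctrl S π x₀ (fun l => w l ω) τ k +
          gainOf S k K *ᵥ predState S π x₀ (fun l => w l ω) τ k :=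
        ((measurable_state_ctrl hπ hM x₀ w τ k hk.le).2 hk).add
          ((measurable_mulVec _).comp hpm)
      have hgm : Measurable[future S w (k - S.M)] fun ω =>
          gainOf S k K *ᵥ driftNoise S (fun l => w l ω) (k - S.M) S.M :=
        (measurable_mulVec _).comp hem
      have hsplit : ∫ ω, quad (ctrlWeight S k K) (ctrl S π x₀ (fun l => w l ω) τ k +
          gainOf S k K *ᵥ state S π x₀ (fun l => w l ω) τ k) ∂μ =
          deviation S μ w x₀ r π k τ +
            ∫ ω, quad (reduction S k K) (driftNoise S (fun l => w l ω) (k - S.M) S.M) ∂μ := by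
        simp only [fun ω => state_eq_predState_add hπ x₀ (fun l => w l ω) τ hk.le hMk hd,
          mulVec_add, ← add_assoc]
        rw [integral_quad_add hv hg (hw.indepFun hvm hgm)
          (by rw [integral_mulVec (he.integrable (by norm_num)), he0, mulVec_zero])]
        simp only [quad_gainOf hR hK]
        rfl
      have i1 := integrable_quad hx (reduction S k K)
      have i2 : Integrable (fun ω => quad (ctrlWeight S k K)
          (ctrl S π x₀ (fun l => w l ω) τ k +
            gainOf S k K *ᵥ state S π x₀ (fun l => w l ω) τ k)) μ :=
        integrable_quad ((hu k hk).add (MemLp.mulVec hx _)) _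
      have i3 : Integrable (fun ω =>
          r * quad (reduction S k K) (state S π x₀ (fun l => w l ω) τ k) -
            quad (reduction S k K) (state S π x₀ (fun l => w l ω) τ k)) μ :=
        (i1.const_mul r).sub i1
      rw [integral_add i3 i2, integral_sub (i1.const_mul r) i1, integral_const_mul, hpyth, hsplit]
      simp only [onInd, predReduction, if_true]
      ring

theorem pathCost_eq_quad (S : Plant n s) (π : Policy n s) (x₀ : Fin n → ℝ) (w : ℕ → Fin n → ℝ)
    (τ : ℕ → Bool) : pathCost S π x₀ w τ = quad (S.Q S.N) (state S π x₀ w τ S.N) +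
      ∑ k ∈ Finset.range S.N,
        (quad (S.Q k) (state S π x₀ w τ k) + quad (S.R k) (ctrl S π x₀ w τ k)) := rfl

/-- The terminal weight cancels because `K_N = Q_N`. Here `r` is a free parameter, unrelated to the
law of the endpoint. -/
theorem pathCost_telescope (S : Plant n s) (r : ℝ) (π : Policy n s) (x₀ : Fin n → ℝ)
    (w : ℕ → Fin n → ℝ) (τ : ℕ → Bool) :
    pathCost S π x₀ w τ = quad (riccati S r 0) x₀ + ∑ k ∈ Finset.range S.N,
      (quad (S.Q k) (state S π x₀ w τ k) + quad (S.R k) (ctrl S π x₀ w τ k) +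
        quad (riccati S r (k + 1)) (state S π x₀ w τ (k + 1)) -
        quad (riccati S r k) (state S π x₀ w τ k)) := by
  have h := Finset.sum_range_sub (fun k => quad (riccati S r k) (state S π x₀ w τ k)) S.N
  rw [riccati_top, state_zero] at h
  rw [pathCost_eq_quad]
  simp only [add_sub_assoc]
  rw [Finset.sum_add_distrib (g := fun k => quad (riccati S r (k + 1)) (state S π x₀ w τ (k + 1)) -
    quad (riccati S r k) (state S π x₀ w τ k)), h]
  ring

theorem integrable_pathCost (hw : Noise S μ w)
    (hu : ∀ i < S.N, MemLp (fun ω => ctrl S π x₀ (fun l => w l ω) τ i) 2 μ) :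
    Integrable (fun ω => pathCost S π x₀ (fun l => w l ω) τ) μ := by
  simp only [pathCost_eq_quad]
  refine (integrable_quad (memLp_state hw le_rfl hu) _).add
    (integrable_finsetSum _ fun k hk => ?_)
  rw [Finset.mem_range] at hk
  exact (integrable_quad (memLp_state hw hk.le fun i hi => hu i (by omega)) _).add
    (integrable_quad (hu k hk) _)

/-- Mean cost along a fixed path of the endpoint. -/
theorem integral_pathCost (hw : Noise S μ w) (hπ : Feasible S π) (hM : 1 ≤ S.M)
    (hQ : ∀ k ≤ S.N, (S.Q k).PosSemidef) (hR : ∀ k < S.N, (S.R k).PosDef)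
    {r : ℝ} (hr0 : 0 ≤ r) (hr1 : r ≤ 1)
    (hu : ∀ i < S.N, MemLp (fun ω => ctrl S π x₀ (fun l => w l ω) τ i) 2 μ) :
    ∫ ω, pathCost S π x₀ (fun l => w l ω) τ ∂μ =
      quad (riccati S r 0) x₀ + ∑ k ∈ Finset.range S.N,
        (noiseCost S μ w x₀ r k + policyCost S μ w x₀ r π k τ) := by
  have hx : ∀ k ≤ S.N, MemLp (fun ω => state S π x₀ (fun l => w l ω) τ k) 2 μ := fun k hk =>
    memLp_state hw hk fun i hi => hu i (by omega)
  have hbase : ∀ k < S.N, Integrable (fun ω => quad (S.Q k) (state S π x₀ (fun l => w l ω) τ k) +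
      quad (S.R k) (ctrl S π x₀ (fun l => w l ω) τ k)) μ := fun k hk =>
    (integrable_quad (hx k hk.le) _).add (integrable_quad (hu k hk) _)
  have hstage : ∀ k ∈ Finset.range S.N, Integrable (fun ω =>
      quad (S.Q k) (state S π x₀ (fun l => w l ω) τ k) +
        quad (S.R k) (ctrl S π x₀ (fun l => w l ω) τ k) +
        quad (riccati S r (k + 1)) (state S π x₀ (fun l => w l ω) τ (k + 1)) -
        quad (riccati S r k) (state S π x₀ (fun l => w l ω) τ k)) μ := fun k hk => by
    rw [Finset.mem_range] at hk
    exact ((hbase k hk).add (integrable_quad (hx (k + 1) hk) _)).sub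
      (integrable_quad (hx k hk.le) _)
  simp only [pathCost_telescope S r]
  rw [integral_add (integrable_const _) (integrable_finsetSum _ hstage),
    integral_finsetSum _ hstage]
  simp only [integral_const, probReal_univ, one_smul]
  congr 1
  refine Finset.sum_congr rfl fun k hk => ?_
  rw [Finset.mem_range] at hk
  rw [← integral_stage hw hπ hM hk (hR k hk) (riccati_posSemidef hr0 hr1 hQ hR hk) hu]
  have hy : MemLp (fun ω => S.A k *ᵥ state S π x₀ (fun l => w l ω) τ k +
      S.B k *ᵥ ctrl S π x₀ (fun l => w l ω) τ k) 2 μ :=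
    (MemLp.mulVec (hx k hk.le) _).add (MemLp.mulVec (hu k hk) _)
  have hm := measurable_state_ctrl hπ hM x₀ w τ k hk.le
  have hym : Measurable[past S w k] fun ω => S.A k *ᵥ state S π x₀ (fun l => w l ω) τ k +
      S.B k *ᵥ ctrl S π x₀ (fun l => w l ω) τ k :=
    ((measurable_mulVec _).comp hm.1).add
      ((measurable_mulVec _).comp ((hm.2 hk).mono (past_mono S w (Nat.sub_le _ _)) le_rfl))
  -- The disturbance `w k` is centered and independent of the state and control at time `k`.
  have hsplit := integral_quad_add hy (hw.memLp k hk)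
    (hw.indepFun hym (measurable_future S w le_rfl hk)) (hw.mean k hk) (riccati S r (k + 1))
  simp only [← state_succ] at hsplit
  have i1 : Integrable (fun ω => quad (S.Q k) (state S π x₀ (fun l => w l ω) τ k) +
        quad (S.R k) (ctrl S π x₀ (fun l => w l ω) τ k) +
        quad (riccati S r (k + 1)) (S.A k *ᵥ state S π x₀ (fun l => w l ω) τ k +
          S.B k *ᵥ ctrl S π x₀ (fun l => w l ω) τ k)) μ :=
    (hbase k hk).add (integrable_quad hy _)
  have i2 : Integrable (fun ω => quad (S.Q k) (state S π x₀ (fun l => w l ω) τ k) +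
        quad (S.R k) (ctrl S π x₀ (fun l => w l ω) τ k) +
        quad (riccati S r (k + 1)) (state S π x₀ (fun l => w l ω) τ (k + 1))) μ :=
    (hbase k hk).add (integrable_quad (hx (k + 1) hk) _)
  rw [integral_sub i1 (integrable_quad (hx k hk.le) _),
    integral_sub i2 (integrable_quad (hx k hk.le) _),
    integral_add (hbase k hk) (integrable_quad hy _),
    integral_add (hbase k hk) (integrable_quad (hx (k + 1) hk) _), hsplit]
  ring

end

/-! ### Averaging over the endpoint: lower and upper bounds. -/

section

variable {n s : ℕ} {Ω : Type*} [MeasurableSpace Ω]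

/-- The contribution of the control at time `k = M` if it is generated at time `0`, when the state
of the endpoint is known. -/
def initialCost (S : Plant n s) (x₀ : Fin n → ℝ) (τ₀ : Bool) (r : ℝ) (k : ℕ) : ℝ :=
  if 0 < k ∧ S.M ∣ k ∧ k ≤ S.MB then
    (r - onInd τ₀) * quad (reduction S k (riccati S r (k + 1))) (drift S 0 0 x₀ 0 S.M)
  else 0

/-- The minimum cost if the endpoint is ON with probability `r` at each positive time. -/
def symCost (S : Plant n s) (μ : Measure Ω) (w : ℕ → Ω → Fin n → ℝ) (x₀ : Fin n → ℝ) (τ₀ : Bool)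
    (r : ℝ) : ℝ :=
  quad (riccati S r 0) x₀ +
    ∑ k ∈ Finset.range S.N, (noiseCost S μ w x₀ r k + initialCost S x₀ τ₀ r k)

variable {S : Plant n s} {μ : Measure Ω} {w : ℕ → Ω → Fin n → ℝ}
  {π : Policy n s} {x₀ : Fin n → ℝ}

theorem pathCost_nonneg (hQ : ∀ k ≤ S.N, (S.Q k).PosSemidef) (hR : ∀ k < S.N, (S.R k).PosDef)
    (w : ℕ → Fin n → ℝ) (τ : ℕ → Bool) : 0 ≤ pathCost S π x₀ w τ := by
  rw [pathCost_eq_quad]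
  refine add_nonneg (quad_nonneg (hQ _ le_rfl) _) (Finset.sum_nonneg fun k hk => ?_)
  rw [Finset.mem_range] at hk
  exact add_nonneg (quad_nonneg (hQ k hk.le) _) (quad_nonneg (hR k hk).posSemidef _)

theorem quad_ctrl_le_pathCost (hQ : ∀ k ≤ S.N, (S.Q k).PosSemidef)
    (hR : ∀ k < S.N, (S.R k).PosDef) (w : ℕ → Fin n → ℝ) (τ : ℕ → Bool) {k : ℕ} (hk : k < S.N) :
    quad (S.R k) (ctrl S π x₀ w τ k) ≤ pathCost S π x₀ w τ := by
  have h : quad (S.Q k) (state S π x₀ w τ k) + quad (S.R k) (ctrl S π x₀ w τ k) ≤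
      ∑ k ∈ Finset.range S.N,
        (quad (S.Q k) (state S π x₀ w τ k) + quad (S.R k) (ctrl S π x₀ w τ k)) :=
    Finset.single_le_sum (f := fun k => quad (S.Q k) (state S π x₀ w τ k) +
      quad (S.R k) (ctrl S π x₀ w τ k)) (fun i hi => by
        rw [Finset.mem_range] at hi
        exact add_nonneg (quad_nonneg (hQ i hi.le) _) (quad_nonneg (hR i hi).posSemidef _))
      (Finset.mem_range.2 hk)
  rw [pathCost_eq_quad]
  linarith [quad_nonneg (hQ S.N le_rfl) (state S π x₀ w τ S.N),
    quad_nonneg (hQ k hk.le) (state S π x₀ w τ k)]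

theorem measurable_quad {m : ℕ} (K : Matrix (Fin m) (Fin m) ℝ) : Measurable (quad K) := by
  have : Continuous (quad K) := by unfold quad; fun_prop
  exact this.measurable

theorem measurable_pathCost (hw : Noise S μ w) (hπ : Feasible S π) (hM : 1 ≤ S.M)
    (τ : ℕ → Bool) : Measurable fun ω => pathCost S π x₀ (fun l => w l ω) τ := by
  simp only [pathCost_eq_quad]
  refine ((measurable_quad _).comp (measurable_state hw hπ hM le_rfl)).add
    (Finset.measurable_sum _ fun k hk => ?_)
  rw [Finset.mem_range] at hk
  exact ((measurable_quad _).comp (measurable_state hw hπ hM hk.le)).add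
    ((measurable_quad _).comp (measurable_ctrl hw hπ hM hk))

theorem deviation_nonneg (hQ : ∀ k ≤ S.N, (S.Q k).PosSemidef) (hR : ∀ k < S.N, (S.R k).PosDef)
    {r : ℝ} (hr0 : 0 ≤ r) (hr1 : r ≤ 1) {k : ℕ} (hk : k < S.N) (τ : ℕ → Bool) :
    0 ≤ deviation S μ w x₀ r π k τ :=
  integral_nonneg fun _ => quad_nonneg
    (ctrlWeight_posDef (hR k hk) (riccati_posSemidef hr0 hr1 hQ hR hk)).posSemidef _

theorem onInd_nonneg (b : Bool) : 0 ≤ onInd b := by cases b <;> simp [onInd]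

variable [IsProbabilityMeasure μ]

theorem cost_eq_sum (hw : Noise S μ w) (hπ : Feasible S π) (hM : 1 ≤ S.M) (τ₀ : Bool) (p q : ℝ) :
    cost S μ w x₀ τ₀ p q π = ∑ t, ENNReal.ofReal (pathProb S.N p q τ₀ t) *
      ∫⁻ ω, ENNReal.ofReal (pathCost S π x₀ (fun l => w l ω) (extendPath t)) ∂μ :=
  lintegral_prod_fogLaw μ S.N p q τ₀ fun _ => (measurable_pathCost hw hπ hM _).ennreal_ofReal

variable {p q : ℝ}

theorem cost_eq_ofReal (hw : Noise S μ w) (hπ : Feasible S π) (hM : 1 ≤ S.M)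
    (hQ : ∀ k ≤ S.N, (S.Q k).PosSemidef) (hR : ∀ k < S.N, (S.R k).PosDef)
    (hp0 : 0 ≤ p) (hp1 : p ≤ 1) (hq0 : 0 ≤ q) (hq1 : q ≤ 1) (τ₀ : Bool)
    (hi : ∀ t, pathProb S.N p q τ₀ t ≠ 0 →
      Integrable (fun ω => pathCost S π x₀ (fun l => w l ω) (extendPath t)) μ) :
    cost S μ w x₀ τ₀ p q π = ENNReal.ofReal (∑ t, pathProb S.N p q τ₀ t *
      ∫ ω, pathCost S π x₀ (fun l => w l ω) (extendPath t) ∂μ) := by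
  rw [cost_eq_sum hw hπ hM, ENNReal.ofReal_sum_of_nonneg fun t _ =>
    mul_nonneg (pathProb_nonneg hp0 hp1 hq0 hq1 _ _)
      (integral_nonneg fun ω => pathCost_nonneg hQ hR _ _)]
  refine Finset.sum_congr rfl fun t _ => ?_
  rw [ENNReal.ofReal_mul (pathProb_nonneg hp0 hp1 hq0 hq1 _ _)]
  -- A path of probability zero may have infinite mean cost; its weight cancels it.
  by_cases h : pathProb S.N p q τ₀ t = 0
  · simp [h]
  · rw [ofReal_integral_eq_lintegral_ofReal (hi t h)
      (Filter.Eventually.of_forall fun ω => pathCost_nonneg hQ hR _ _)]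

/-- A finite total cost is finite on each path of positive probability, and there `R_k` controls the
second moment of the input. This makes the exact formula available for arbitrary policies of finite
cost. -/
theorem memLp_ctrl_of_cost_ne_top (hw : Noise S μ w) (hπ : Feasible S π) (hM : 1 ≤ S.M)
    (hQ : ∀ k ≤ S.N, (S.Q k).PosSemidef) (hR : ∀ k < S.N, (S.R k).PosDef)
    (hp0 : 0 ≤ p) (hp1 : p ≤ 1) (hq0 : 0 ≤ q) (hq1 : q ≤ 1) {τ₀ : Bool}
    (hfin : cost S μ w x₀ τ₀ p q π ≠ ⊤) {t : Fin (S.N + 1) → Bool}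
    (ht : pathProb S.N p q τ₀ t ≠ 0) {k : ℕ} (hk : k < S.N) :
    MemLp (fun ω => ctrl S π x₀ (fun l => w l ω) (extendPath t) k) 2 μ := by
  have hpos : 0 < pathProb S.N p q τ₀ t :=
    lt_of_le_of_ne (pathProb_nonneg hp0 hp1 hq0 hq1 _ _) (Ne.symm ht)
  rw [cost_eq_sum hw hπ hM] at hfin
  have h1 := (ENNReal.sum_ne_top.1 hfin) t (Finset.mem_univ _)
  have h2 : ∫⁻ ω, ENNReal.ofReal (pathCost S π x₀ (fun l => w l ω) (extendPath t)) ∂μ ≠ ⊤ := by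
    intro h
    rw [h, ENNReal.mul_top (by simpa using hpos)] at h1
    exact h1 rfl
  have hm := measurable_pathCost (x₀ := x₀) hw hπ hM (extendPath t)
  have hint : Integrable (fun ω => pathCost S π x₀ (fun l => w l ω) (extendPath t)) μ :=
    (lintegral_ofReal_ne_top_iff_integrable hm.aestronglyMeasurable
      (Filter.Eventually.of_forall fun ω => pathCost_nonneg hQ hR _ _)).1 h2
  have hc := measurable_ctrl (x₀ := x₀) (τ := extendPath t) hw hπ hM hk
  refine memLp_two_of_integrable_quad hc.aestronglyMeasurable (hR k hk)
    (hint.mono' ((measurable_quad _).comp hc).aestronglyMeasurable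
      (Filter.Eventually.of_forall fun ω => ?_))
  rw [Real.norm_of_nonneg (quad_nonneg (hR k hk).posSemidef _)]
  exact quad_ctrl_le_pathCost hQ hR _ _ hk

/-- Comparison of the mean of `(r - 1_{ON}) * predReduction` with its value for an endpoint that is
ON with probability `r`; the sign of `c` selects the direction. -/
theorem initialCost_le (hπ : Feasible S π) (hM : 1 ≤ S.M)
    (hQ : ∀ k ≤ S.N, (S.Q k).PosSemidef) (hR : ∀ k < S.N, (S.R k).PosDef)
    (hp0 : 0 ≤ p) (hp1 : p ≤ 1) (hq0 : 0 ≤ q) (hq1 : q ≤ 1) (τ₀ : Bool)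
    {c r : ℝ} (hr0 : 0 ≤ r) (hr1 : r ≤ 1) (hr : ∀ b, 0 ≤ c * (r - fogTrans p q b true))
    {k : ℕ} (hk : k < S.N) (hk0 : 0 < k) (hd : S.M ∣ k) :
    c * initialCost S x₀ τ₀ r k ≤ c * ∑ t, pathProb S.N p q τ₀ t *
      ((r - onInd (extendPath t (k - S.MB))) *
        predReduction S μ w x₀ r π k (extendPath t)) := by
  have hMk : S.M ≤ k := Nat.le_of_dvd hk0 hd
  have hMdef : S.M = S.MF + S.MB := rfl
  -- With `M ≤ k` this forces `MF = 0` and `k = M = MB`: the control is generated at time `0`, where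
  -- the state of the chain is given and the prediction is deterministic, so equality holds.
  by_cases hkB : k ≤ S.MB
  · rw [initialCost, if_pos ⟨hk0, hd, hkB⟩]
    have hkM : k - S.M = 0 := by omega
    have hpred : ∀ τ, predReduction S μ w x₀ r π k τ =
        quad (reduction S k (riccati S r (k + 1))) (drift S 0 0 x₀ 0 S.M) := fun τ => by
      simp only [predReduction, predState, hkM, state_zero,
        ctrl_eq_zero hπ x₀ _ τ (show 0 < S.N by omega) (Or.inl rfl)]
      simp
    have hterm : ∀ t, pathProb S.N p q τ₀ t * ((r - onInd (extendPath t (k - S.MB))) *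
        predReduction S μ w x₀ r π k (extendPath t)) = pathProb S.N p q τ₀ t *
        ((r - onInd τ₀) *
          quad (reduction S k (riccati S r (k + 1))) (drift S 0 0 x₀ 0 S.M)) := fun t => by
      rw [hpred, show k - S.MB = 0 by omega]
      by_cases h0 : t 0 = τ₀
      · have : extendPath t 0 = τ₀ := by rw [← h0]; simp [extendPath]
        rw [this]
      · simp [pathProb, h0]
    simp only [hterm]
    rw [← Finset.sum_mul, sum_pathProb, one_mul]
  · rw [initialCost, if_neg (by tauto), mul_zero]
    refine sum_pathProb_mul_nonneg hp0 hp1 hq0 hq1 τ₀ (by omega) (by omega) hr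
      (g := predReduction S μ w x₀ r π k) (fun τ => ?_) fun τ τ' h => ?_
    -- No integrability is needed: the default value `0` of an integral is nonnegative too.
    · exact integral_nonneg fun ω => quad_nonneg
        (reduction_posSemidef (hR k hk) (riccati_posSemidef hr0 hr1 hQ hR hk)) _
    -- The prediction involves endpoint times at most `k - M - MB`, which precede `k - MB` because
    -- `M ≥ 1`.
    · have hc : ∀ w : ℕ → Fin n → ℝ, predState S π x₀ w τ k = predState S π x₀ w τ' k := fun w => by
        have := state_ctrl_congr hπ x₀ w (k - S.M) (by omega) fun j hj => h j (by omega)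
        rw [predState, predState, this.1, this.2]
      simp only [predReduction, hc]

theorem sum_pathProb_mul_cost (hw : Noise S μ w) (hπ : Feasible S π) (hM : 1 ≤ S.M)
    (hQ : ∀ k ≤ S.N, (S.Q k).PosSemidef) (hR : ∀ k < S.N, (S.R k).PosDef) (τ₀ : Bool)
    {r : ℝ} (hr0 : 0 ≤ r) (hr1 : r ≤ 1)
    (hu : ∀ t, pathProb S.N p q τ₀ t ≠ 0 → ∀ i < S.N,
      MemLp (fun ω => ctrl S π x₀ (fun l => w l ω) (extendPath t) i) 2 μ) :
    ∑ t, pathProb S.N p q τ₀ t * ∫ ω, pathCost S π x₀ (fun l => w l ω) (extendPath t) ∂μ =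
      quad (riccati S r 0) x₀ + ∑ k ∈ Finset.range S.N, (noiseCost S μ w x₀ r k +
        ∑ t, pathProb S.N p q τ₀ t * policyCost S μ w x₀ r π k (extendPath t)) := by
  have h : ∀ t, pathProb S.N p q τ₀ t *
      ∫ ω, pathCost S π x₀ (fun l => w l ω) (extendPath t) ∂μ = pathProb S.N p q τ₀ t *
      (quad (riccati S r 0) x₀ + ∑ k ∈ Finset.range S.N, noiseCost S μ w x₀ r k) +
      ∑ k ∈ Finset.range S.N,
        pathProb S.N p q τ₀ t * policyCost S μ w x₀ r π k (extendPath t) := fun t => by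
    by_cases h0 : pathProb S.N p q τ₀ t = 0
    · simp [h0]
    · rw [integral_pathCost hw hπ hM hQ hR hr0 hr1 (hu t h0), Finset.sum_add_distrib,
        ← Finset.mul_sum]
      ring
  simp only [h]
  rw [Finset.sum_add_distrib, ← Finset.sum_mul, sum_pathProb, one_mul, Finset.sum_comm,
    Finset.sum_add_distrib, add_assoc]

/-- Lower bound for the cost if the ON-probability never exceeds `r`. -/
theorem symCost_le_cost (hw : Noise S μ w) (hπ : Feasible S π) (hM : 1 ≤ S.M)
    (hQ : ∀ k ≤ S.N, (S.Q k).PosSemidef) (hR : ∀ k < S.N, (S.R k).PosDef)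
    (hp0 : 0 ≤ p) (hp1 : p ≤ 1) (hq0 : 0 ≤ q) (hq1 : q ≤ 1) (τ₀ : Bool)
    {r : ℝ} (hr0 : 0 ≤ r) (hr1 : r ≤ 1) (hr : ∀ b, fogTrans p q b true ≤ r) :
    ENNReal.ofReal (symCost S μ w x₀ τ₀ r) ≤ cost S μ w x₀ τ₀ p q π := by
  by_cases hfin : cost S μ w x₀ τ₀ p q π = ⊤
  · rw [hfin]; exact le_top
  have hu : ∀ t, pathProb S.N p q τ₀ t ≠ 0 → ∀ i < S.N,
      MemLp (fun ω => ctrl S π x₀ (fun l => w l ω) (extendPath t) i) 2 μ := fun t ht i hi =>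
    memLp_ctrl_of_cost_ne_top hw hπ hM hQ hR hp0 hp1 hq0 hq1 hfin ht hi
  rw [cost_eq_ofReal hw hπ hM hQ hR hp0 hp1 hq0 hq1 τ₀ fun t ht =>
    integrable_pathCost hw (hu t ht), sum_pathProb_mul_cost hw hπ hM hQ hR τ₀ hr0 hr1 hu]
  refine ENNReal.ofReal_le_ofReal (add_le_add le_rfl (Finset.sum_le_sum fun k hk =>
    add_le_add le_rfl ?_))
  rw [Finset.mem_range] at hk
  by_cases hm : 0 < k ∧ S.M ∣ k
  · have h := initialCost_le (μ := μ) (w := w) (x₀ := x₀) hπ hM hQ hR hp0 hp1 hq0 hq1 τ₀ (c := 1)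
      hr0 hr1 (fun b => by linarith [hr b]) hk hm.1 hm.2
    rw [one_mul, one_mul] at h
    -- The lower bound discards the nonnegative deviation.
    refine h.trans (Finset.sum_le_sum fun t _ => ?_)
    refine mul_le_mul_of_nonneg_left ?_ (pathProb_nonneg hp0 hp1 hq0 hq1 _ _)
    rw [policyCost, if_pos hm]
    linarith [mul_nonneg (onInd_nonneg (extendPath t (k - S.MB)))
      (deviation_nonneg (μ := μ) (w := w) (x₀ := x₀) (π := π) hQ hR hr0 hr1 hk (extendPath t))]
  · rw [initialCost, if_neg (by tauto)]
    simp [policyCost, hm]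

theorem feasible_symPolicy (hw : Noise S μ w) (r : ℝ) : Feasible S (symPolicy S μ w r) where
  measurable k hk := by
    by_cases hz : k = 0 ∨ ¬ S.M ∣ k
    · have : ∀ o u b, symPolicy S μ w r k o u b = 0 := fun o u b => by
        rw [symPolicy, if_neg]
        rintro ⟨h0, hd, -⟩
        exact hz.elim (fun h => by omega) fun h => h hd
      simp only [this]
      exact measurable_const
    · have hMk := le_of_pos_of_dvd hz
      unfold symPolicy
      refine Measurable.ite ?_ ?_ measurable_const
      · have hb : Measurable fun h : Obs n × (ℕ → Fin s → ℝ) × Bool => h.2.2 :=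
          measurable_snd.comp measurable_snd
        exact hb (MeasurableSet.of_discrete (s := {b : Bool | 0 < k ∧ S.M ∣ k ∧ b = true}))
      · simp only [hw.predict_eq hk.le hMk]
        refine ((measurable_mulVec _).comp ((measurable_drift_zero S (k - S.M) S.M).comp
          (Measurable.prodMk ?_ ?_))).neg
        · exact measurable_snd.comp ((measurable_pi_apply _).comp measurable_fst)
        · exact (measurable_pi_apply _).comp (measurable_fst.comp measurable_snd)
  off k _ o u := by simp [symPolicy]
  spread k _ h o u b := by
    rw [symPolicy, if_neg]
    rintro ⟨h0, hd, -⟩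
    exact h.elim (fun h => by omega) fun h => h hd

/-- The control of `symPolicy` is the optimal feedback applied to the predicted state. -/
theorem ctrl_symPolicy (hw : Noise S μ w) (hM : 1 ≤ S.M) (r : ℝ) (v : ℕ → Fin n → ℝ)
    {τ : ℕ → Bool} {k : ℕ} (hk : k < S.N) (hk0 : 0 < k) (hd : S.M ∣ k)
    (hτ : τ (k - S.MB) = true) :
    ctrl S (symPolicy S μ w r) x₀ v τ k = -(gainOf S k (riccati S r (k + 1)) *ᵥ
      predState S (symPolicy S μ w r) x₀ v τ k) := by
  have hMk : S.M ≤ k := Nat.le_of_dvd hk0 hd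
  have hMdef : S.M = S.MF + S.MB := rfl
  -- The state `x (k - M)` reaches the endpoint exactly when the control is generated, so an
  -- endpoint that is ON has received it.
  have hτ' : τ (k - S.M + S.MF) = true := by
    rwa [show k - S.M + S.MF = k - S.MB by omega]
  rw [ctrl_eq]
  conv_lhs => rw [symPolicy]
  rw [if_pos ⟨hk0, hd, hτ⟩, hw.predict_eq hk.le hMk, if_pos (by omega), received,
    if_pos ⟨by omega, hτ'⟩, predState]

theorem memLp_ctrl_symPolicy (hw : Noise S μ w) (hM : 1 ≤ S.M) (r : ℝ) (τ : ℕ → Bool) {k : ℕ}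
    (hk : k < S.N) :
    MemLp (fun ω => ctrl S (symPolicy S μ w r) x₀ (fun l => w l ω) τ k) 2 μ := by
  induction k using Nat.strong_induction_on with
  | _ k ih =>
    have hπ := feasible_symPolicy hw r
    by_cases hz : k = 0 ∨ ¬ S.M ∣ k
    · simp only [ctrl_eq_zero hπ x₀ _ τ hk hz]
      exact memLp_const _
    · have hMk := le_of_pos_of_dvd hz
      obtain ⟨h0, hd⟩ : k ≠ 0 ∧ S.M ∣ k := by simpa using hz
      cases hτ : τ (k - S.MB) with
      | false =>
        simp only [ctrl_eq_zero_of_off hπ x₀ _ hk hτ]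
        exact memLp_const _
      | true =>
        simp only [ctrl_symPolicy hw hM r _ hk (Nat.pos_of_ne_zero h0) hd hτ]
        refine (MemLp.mulVec (memLp_drift_zero (memLp_state hw (by omega) fun i hi => ?_) ?_ _ _)
          _).neg
        · exact ih i (by omega) (by omega)
        · exact ih _ (by omega) (by omega)

/-- Upper bound for the cost of `symPolicy` if the ON-probability is never less than `r`. -/
theorem cost_symPolicy_le (hw : Noise S μ w) (hM : 1 ≤ S.M)
    (hQ : ∀ k ≤ S.N, (S.Q k).PosSemidef) (hR : ∀ k < S.N, (S.R k).PosDef)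
    (hp0 : 0 ≤ p) (hp1 : p ≤ 1) (hq0 : 0 ≤ q) (hq1 : q ≤ 1) (τ₀ : Bool)
    {r : ℝ} (hr0 : 0 ≤ r) (hr1 : r ≤ 1) (hr : ∀ b, r ≤ fogTrans p q b true) :
    cost S μ w x₀ τ₀ p q (symPolicy S μ w r) ≤ ENNReal.ofReal (symCost S μ w x₀ τ₀ r) := by
  have hπ := feasible_symPolicy hw r
  have hu : ∀ t, pathProb S.N p q τ₀ t ≠ 0 → ∀ i < S.N,
      MemLp (fun ω => ctrl S (symPolicy S μ w r) x₀ (fun l => w l ω) (extendPath t) i) 2 μ :=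
    fun t _ i hi => memLp_ctrl_symPolicy hw hM r _ hi
  rw [cost_eq_ofReal hw hπ hM hQ hR hp0 hp1 hq0 hq1 τ₀ fun t ht =>
    integrable_pathCost hw (hu t ht), sum_pathProb_mul_cost hw hπ hM hQ hR τ₀ hr0 hr1 hu]
  refine ENNReal.ofReal_le_ofReal (add_le_add le_rfl (Finset.sum_le_sum fun k hk =>
    add_le_add le_rfl ?_))
  rw [Finset.mem_range] at hk
  by_cases hm : 0 < k ∧ S.M ∣ k
  · have h := initialCost_le (μ := μ) (w := w) (x₀ := x₀) hπ hM hQ hR hp0 hp1 hq0 hq1 τ₀ (c := -1)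
      hr0 hr1 (fun b => by linarith [hr b]) hk hm.1 hm.2
    have h' := le_of_neg_le_neg (by simpa only [neg_one_mul] using h)
    refine le_trans (le_of_eq (Finset.sum_congr rfl fun t _ => ?_)) h'
    rw [policyCost, if_pos hm]
    -- Nothing is discarded here: the deviation is zero when ON, its factor is zero when OFF.
    have hdev : onInd (extendPath t (k - S.MB)) *
        deviation S μ w x₀ r (symPolicy S μ w r) k (extendPath t) = 0 := by
      cases hτ : extendPath t (k - S.MB) with
      | false => simp [onInd]
      | true =>
        have : deviation S μ w x₀ r (symPolicy S μ w r) k (extendPath t) = 0 := by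
          simp only [deviation, ctrl_symPolicy hw hM r _ hk hm.1 hm.2 hτ, neg_add_cancel,
            quad_zero, integral_zero]
        rw [this, mul_zero]
    rw [hdev, zero_add]
  · rw [initialCost, if_neg (by tauto)]
    simp [policyCost, hm]

end

end Fog

end

/-! ### Comparison of the systems `(p, 1 - p)`, `(p, q)` and `(1 - q, q)`. -/

theorem theorem6 {n s : ℕ} (S : Fog.Plant n s) (hM : 1 ≤ S.M)
    (hQ : ∀ k ≤ S.N, (S.Q k).PosSemidef) (hR : ∀ k < S.N, (S.R k).PosDef)
    {Ω : Type*} [MeasurableSpace Ω] (μ : MeasureTheory.Measure Ω)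
    [MeasureTheory.IsProbabilityMeasure μ]
    (w : ℕ → Ω → Fin n → ℝ) (hw : ∀ k < S.N, Measurable (w k))
    (hw2 : ∀ k < S.N, MeasureTheory.MemLp (w k) 2 μ)
    (hw0 : ∀ k < S.N, ∫ ω, w k ω ∂μ = 0)
    (hind : ProbabilityTheory.iIndepFun (fun k : Fin S.N => w k) μ)
    (x₀ : Fin n → ℝ) (τ₀ : Bool)
    (p q : ℝ) (hp : p ≤ 1) (hq0 : 0 ≤ q) (hq1 : q ≤ 1) (hpq : 1 - q < p) :
    Fog.minCost S μ w x₀ τ₀ p q ≤ Fog.minCost S μ w x₀ τ₀ (1 - q) q ∧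
    Fog.minCost S μ w x₀ τ₀ p (1 - p) ≤ Fog.minCost S μ w x₀ τ₀ p q ∧
    Fog.minCost S μ w x₀ τ₀ (1 - q) q < ⊤ ∧
    Fog.Feasible S (Fog.symPolicy S μ w (1 - q)) ∧
    Fog.cost S μ w x₀ τ₀ (1 - q) q (Fog.symPolicy S μ w (1 - q)) =
      Fog.minCost S μ w x₀ τ₀ (1 - q) q ∧
    Fog.minCost S μ w x₀ τ₀ p (1 - p) ≤
      Fog.cost S μ w x₀ τ₀ p q (Fog.symPolicy S μ w (1 - q)) ∧
    Fog.cost S μ w x₀ τ₀ p q (Fog.symPolicy S μ w (1 - q)) ≤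
      Fog.minCost S μ w x₀ τ₀ (1 - q) q := by
  have hp0 : 0 ≤ p := by linarith
  have hNoise : Fog.Noise S μ w := ⟨hw, hw2, hw0, hind⟩
  have h1q0 : 0 ≤ 1 - q := by linarith
  have h1q1 : 1 - q ≤ 1 := by linarith
  have h1p0 : 0 ≤ 1 - p := by linarith
  have h1p1 : 1 - p ≤ 1 := by linarith
  have hfeas : ∀ r, Fog.Feasible S (Fog.symPolicy S μ w r) := Fog.feasible_symPolicy hNoise
  have hmin : ∀ (p q : ℝ) (π : Fog.Policy n s), Fog.Feasible S π →
      Fog.minCost S μ w x₀ τ₀ p q ≤ Fog.cost S μ w x₀ τ₀ p q π := fun p q π hπ => iInf₂_le π hπ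
  -- For `(1 - q, q)` both rows of the chain have ON-probability `1 - q`, so both bounds hold with
  -- `r = 1 - q` and their agreement gives optimality.
  have hupQ : Fog.cost S μ w x₀ τ₀ (1 - q) q (Fog.symPolicy S μ w (1 - q)) ≤
      ENNReal.ofReal (Fog.symCost S μ w x₀ τ₀ (1 - q)) :=
    Fog.cost_symPolicy_le hNoise hM hQ hR h1q0 h1q1 hq0 hq1 τ₀ h1q0 h1q1
      fun b => by cases b <;> exact le_rfl
  have hloQ : ENNReal.ofReal (Fog.symCost S μ w x₀ τ₀ (1 - q)) ≤
      Fog.minCost S μ w x₀ τ₀ (1 - q) q :=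
    le_iInf₂ fun π hπ => Fog.symCost_le_cost hNoise hπ hM hQ hR h1q0 h1q1 hq0 hq1 τ₀ h1q0 h1q1
      fun b => by cases b <;> exact le_rfl
  -- For `(p, q)` the smaller ON-probability is `1 - q`, attained from OFF; the larger one, `p`,
  -- serves in `hloP`.
  have hupPQ : Fog.cost S μ w x₀ τ₀ p q (Fog.symPolicy S μ w (1 - q)) ≤
      ENNReal.ofReal (Fog.symCost S μ w x₀ τ₀ (1 - q)) :=
    Fog.cost_symPolicy_le hNoise hM hQ hR hp0 hp hq0 hq1 τ₀ h1q0 h1q1 fun b => by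
      cases b
      · exact le_rfl
      · exact hpq.le
  have hupP : Fog.cost S μ w x₀ τ₀ p (1 - p) (Fog.symPolicy S μ w p) ≤
      ENNReal.ofReal (Fog.symCost S μ w x₀ τ₀ p) :=
    Fog.cost_symPolicy_le hNoise hM hQ hR hp0 hp h1p0 h1p1 τ₀ hp0 hp
      fun b => by cases b <;> simp [Fog.fogTrans]
  have hloP : ∀ π, Fog.Feasible S π → ENNReal.ofReal (Fog.symCost S μ w x₀ τ₀ p) ≤
      Fog.cost S μ w x₀ τ₀ p q π := fun π hπ =>
    Fog.symCost_le_cost hNoise hπ hM hQ hR hp0 hp hq0 hq1 τ₀ hp0 hp fun b => by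
      cases b
      · exact hpq.le
      · exact le_rfl
  have hP := (hmin p (1 - p) _ (hfeas p)).trans hupP
  have hQ' := (hmin (1 - q) q _ (hfeas (1 - q))).trans hupQ
  exact ⟨((hmin p q _ (hfeas _)).trans hupPQ).trans hloQ,
    le_iInf₂ fun π hπ => hP.trans (hloP π hπ),
    hQ'.trans_lt ENNReal.ofReal_lt_top, hfeas _,
    le_antisymm (hupQ.trans hloQ) (hmin _ _ _ (hfeas _)),
    hP.trans (hloP _ (hfeas _)), hupPQ.trans hloQ⟩
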